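/- Let $\mathcal A=\{0,1,2,3\}$ and let $\partial\mathcal A^*$ be the space of infinite words $x=\varepsilon_1\varepsilon_2\cdots$ over $\mathcal A$ with the distance $d(x,y)=4^{-|x\wedge y|}$ for $x\ne y$, where $|x\wedge y|$ is the length of the longest common prefix. Let $(T_k)_{k\ge1}$ be integers with $T_1=1$, $T_k<T_{k+1}$ and $T_{k+1}/T_k\to+\infty$. Let $0<a_1<a_2<a_3<a_4<1$ and $0<b_1<b_2<b_3<b_4<1$ with $\sum a_i=\sum b_i=1$ be such that the functions $q\mapsto\log\sum_i a_i^q$ and $q\mapsto\log\sum_i b_i^q$ have the same derivative at $q=0$ and the same derivative at $q=1$; let $a_1<b_1$. Let $\mu$ be the probability measure on $\partial\mathcal A^*$ with $$\mu([\varepsilon_1\cdots\varepsilon_n])=\prod_{j=1}^n p_j,\qquad p_j=a_{\varepsilon_j+1}\ \text{if } T_{2k-1}\le j<T_{2k}\text{ for some }k\ge1,\qquad p_j=b_{\varepsilon_j+1}\ \text{if } T_{2k}\le j<T_{2k+1}\text{ for some }k\ge1,$$ or the measure obtained in the same way with the roles of $a$ and $b$ in the two kinds of blocks exchanged. Let $S_\mu$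 be the support of $\mu$. For $q,t\in\mathbb R$ and $E\subset\partial\mathcal A^*$ put $$\overline{\mathscr H}^{q,t}_\mu(E)=\sup_{\delta>0}\inf\sum_i r_i^t\mu(B(x_i,r_i))^q,\quad \mathscr H^{q,t}_\mu(E)=\sup_{F\subset E}\overline{\mathscr H}^{q,t}_\mu(F),$$ the infimum being over countable coverings of $E$ by open balls with centres $x_i\in E$ and radii $0<r_i<\delta$, and $$\overline{\mathscr P}^{q,t}_\mu(E)=\inf_{\delta>0}\sup\sum_i r_i^t\mu(B(x_i,r_i))^q,\quad \mathscr P^{q,t}_\mu(E)=\inf_{E\subset\bigcup_i E_i}\sum_i\overline{\mathscr P}^{q,t}_\mu(E_i),$$ the supremum being over countable families of pairwise disjoint open balls with centres $x_i\in E$ and radii $0<r_i<\delta$ (terms with $0$ raised to a negative power are omitted). Olsen's functions of $\mu$ are $b(q)=\sup\{s:\mathscr H^{q,s}_\mu(S_\mu)=\infty\}$ and $B(q)=\sup\{s:\mathscr P^{q,s}_\mu(S_\mu)=\infty\}$. Write $f^*(\alpha)=\inf_{y\in\mathbb R}(\alpha y+f(y))$, and let $$X(\alpha)=\Big\{x\in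 S_\mu:\ \lim_{r\to0}\frac{\log\mu(B(x,r))}{\log r}=\alpha\Big\}.$$ Then, for all $q\in\mathbb R$, $B(q)=\log_4\sum_{i=1}^4a_i^q$ and $b(q)=\log_4\sum_{i=1}^4b_i^q$, and for every $\alpha\in(-\log_4b_4,-\log_4b_1)$ the Hausdorff dimension of $X(\alpha)$ equals $b^*(\alpha)$ and the packing dimension of $X(\alpha)$ equals $B^*(\alpha)$. -/

import Mathlib

open MeasureTheory Filter Topology
open scoped ENNReal NNReal

namespace OlsenMultifractal

/-! ## Olsen's multifractal measures and functions on a metric space -/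

section Olsen

variable {X : Type*} [MetricSpace X]

/-- `S` lists the pairs (centre, radius) of a countable centred `δ`-covering of `E` by open balls. -/
def IsCenteredCovering (δ : ℝ) (E : Set X) (S : Set (X × ℝ)) : Prop :=
  S.Countable ∧ (∀ p ∈ S, p.1 ∈ E ∧ 0 < p.2 ∧ p.2 < δ) ∧ E ⊆ ⋃ p ∈ S, Metric.ball p.1 p.2

/-- `S` lists the pairs (centre, radius) of a countable `δ`-packing of `E` by open balls. -/
def IsPacking (δ : ℝ) (E : Set X) (S : Set (X × ℝ)) : Prop :=
  S.Countable ∧ (∀ p ∈ S, p.1 ∈ E ∧ 0 < p.2 ∧ p.2 < δ) ∧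
    S.PairwiseDisjoint (fun p => Metric.ball p.1 p.2)

/-- The packing premeasure at scale `δ` attached to a weight `w` on the balls `B(x, r)`. -/
noncomputable def prePackingAt (w : X × ℝ → ℝ≥0∞) (δ : ℝ) (E : Set X) : ℝ≥0∞ :=
  ⨆ (S : Set (X × ℝ)) (_ : IsPacking δ E S), ∑' p : S, w p

/-- The packing premeasure attached to a weight on balls. -/
noncomputable def prePacking (w : X × ℝ → ℝ≥0∞) (E : Set X) : ℝ≥0∞ :=
  ⨅ (δ : ℝ) (_ : 0 < δ), prePackingAt w δ E

/-- The packing measure attached to a weight on balls. -/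
noncomputable def packing (w : X × ℝ → ℝ≥0∞) (E : Set X) : ℝ≥0∞ :=
  ⨅ (U : ℕ → Set X) (_ : E ⊆ ⋃ i, U i), ∑' i, prePacking w (U i)

/-- The centred covering quantity at scale `δ` attached to a weight on balls. -/
noncomputable def preHausdorffAt (w : X × ℝ → ℝ≥0∞) (δ : ℝ) (E : Set X) : ℝ≥0∞ :=
  ⨅ (S : Set (X × ℝ)) (_ : IsCenteredCovering δ E S), ∑' p : S, w p

/-- The limit of `preHausdorffAt w δ E` as `δ` decreases to `0`. -/
noncomputable def preHausdorff (w : X × ℝ → ℝ≥0∞) (E : Set X) : ℝ≥0∞ :=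
  ⨆ (δ : ℝ) (_ : 0 < δ), preHausdorffAt w δ E

/-- The centred Hausdorff measure attached to a weight on balls. -/
noncomputable def centeredHausdorff (w : X × ℝ → ℝ≥0∞) (E : Set X) : ℝ≥0∞ :=
  ⨆ (F : Set X) (_ : F ⊆ E), preHausdorff w F

/-- The packing dimension: the critical exponent of the packing measures with weight `r ^ t`. -/
noncomputable def packingDim (E : Set X) : ℝ≥0∞ :=
  ⨆ (t : ℝ≥0) (_ : packing (fun p : X × ℝ => ENNReal.ofReal p.2 ^ (t : ℝ)) E = ∞), (t : ℝ≥0∞)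

variable [MeasurableSpace X]

open scoped Classical in
/-- The weight `r ^ t * μ(B(x, r)) ^ q`; the infinite terms, where `μ(B(x, r)) = 0` is raised to a
negative power, are omitted from the sums. -/
noncomputable def olsenWeight (μ : Measure X) (q t : ℝ) (p : X × ℝ) : ℝ≥0∞ :=
  if μ (Metric.ball p.1 p.2) = 0 ∧ q < 0 then 0
  else ENNReal.ofReal p.2 ^ t * μ (Metric.ball p.1 p.2) ^ q

/-- Olsen's function `b_μ` on the support of `μ`: the critical exponent of the multifractal centred
Hausdorff measures. -/
noncomputable def olsenb (μ : Measure X) (q : ℝ) : EReal :=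
  ⨆ (s : ℝ) (_ : centeredHausdorff (olsenWeight μ q s) μ.support = ∞), (s : EReal)

/-- Olsen's function `B_μ` on the support of `μ`: the critical exponent of the multifractal packing
measures. -/
noncomputable def olsenB (μ : Measure X) (q : ℝ) : EReal :=
  ⨆ (s : ℝ) (_ : packing (olsenWeight μ q s) μ.support = ∞), (s : EReal)

/-- The upper local Hölder exponent of `μ` at a point `x` of its support. -/
noncomputable def upperLocalDim (μ : Measure X) (x : X) : EReal :=
  limsup (fun r : ℝ => ((Real.log (μ.real (Metric.ball x r)) / Real.log r : ℝ) : EReal)) (𝓝[>] 0)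

/-- The lower local Hölder exponent of `μ` at a point `x` of its support. -/
noncomputable def lowerLocalDim (μ : Measure X) (x : X) : EReal :=
  liminf (fun r : ℝ => ((Real.log (μ.real (Metric.ball x r)) / Real.log r : ℝ) : EReal)) (𝓝[>] 0)

/-- The level set `X_μ(α)` of the local Hölder exponents. -/
def levelSet (μ : Measure X) (α : ℝ) : Set X :=
  {x | x ∈ μ.support ∧ (α : EReal) ≤ lowerLocalDim μ x ∧ upperLocalDim μ x ≤ (α : EReal)}

end Olsen

/-- The Legendre transform `f*(x) = inf_y (x y + f(y))`. -/
noncomputable def legendre (f : ℝ → EReal) (x : ℝ) : EReal :=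
  ⨅ y : ℝ, ((x * y : ℝ) : EReal) + f y

/-! ## The symbolic space over four letters -/

/-- The space `∂𝒜*` of infinite words over `𝒜 = {0, 1, 2, 3}`. The `j`-th letter (`j ≥ 1`) of the
word `x` is `x (j - 1)`. -/
abbrev SymbolicSpace : Type := ℕ → Fin 4

namespace SymbolicSpace

open scoped Classical in
/-- The distance `4 ^ (-|x ∧ y|)`, where `|x ∧ y|` is the length of the longest common prefix. -/
noncomputable def wdist (x y : SymbolicSpace) : ℝ :=
  if x = y then 0 else ((4 : ℝ) ^ PiNat.firstDiff (E := fun _ => Fin 4) x y)⁻¹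

lemma wdist_eq_sq (x y : SymbolicSpace) :
    wdist x y = (PiNat.dist (E := fun _ => Fin 4)).dist x y ^ 2 := by
  classical
  by_cases h : x = y
  · subst h
    rw [wdist, if_pos rfl, PiNat.dist_self]; norm_num
  · rw [wdist, if_neg h, PiNat.dist_eq_of_ne h, ← pow_mul, mul_comm, pow_mul, ← inv_pow]
    norm_num

/-- The metric of the symbolic space. Its topology is the product topology of `ℕ → Fin 4`, so that the
product σ-algebra is the Borel σ-algebra. -/
noncomputable instance instMetricSpace : MetricSpace SymbolicSpace :=
  letI : Dist SymbolicSpace := ⟨wdist⟩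
  MetricSpace.ofDistTopology wdist
    (fun x => by rw [wdist_eq_sq, PiNat.dist_self]; norm_num)
    (fun x y => by rw [wdist_eq_sq, wdist_eq_sq, PiNat.dist_comm])
    (fun x y z => by
      rw [wdist_eq_sq, wdist_eq_sq, wdist_eq_sq]
      have h := PiNat.dist_triangle_nonarch (E := fun _ => Fin 4) x y z
      have h0 := PiNat.dist_nonneg (E := fun _ => Fin 4) x z
      rcases le_max_iff.1 h with h | h
      · exact (pow_le_pow_left₀ h0 h 2).trans (le_add_of_nonneg_right (sq_nonneg _))
      · exact (pow_le_pow_left₀ h0 h 2).trans (le_add_of_nonneg_left (sq_nonneg _)))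
    (fun s => by
      refine (PiNat.isOpen_iff_dist (E := fun _ => Fin 4) s).trans ?_
      refine forall₂_congr fun x _ => ⟨?_, ?_⟩
      · rintro ⟨ε, hε, h⟩
        refine ⟨ε ^ 2, by positivity, fun y hy => h y ?_⟩
        rw [wdist_eq_sq] at hy
        exact lt_of_pow_lt_pow_left₀ 2 hε.le hy
      · rintro ⟨ε, hε, h⟩
        refine ⟨√ε, Real.sqrt_pos.2 hε, fun y hy => h y ?_⟩
        rw [wdist_eq_sq]
        exact (Real.lt_sqrt (PiNat.dist_nonneg _ _)).1 hy)
    (fun x y h => by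
      rw [wdist_eq_sq] at h
      exact PiNat.eq_of_dist_eq_zero (E := fun _ => Fin 4) x y (pow_eq_zero_iff two_ne_zero |>.1 h))

/-- The cylinder of the infinite words that begin with the first `n` letters of `x`. -/
def cyl (x : SymbolicSpace) (n : ℕ) : Set SymbolicSpace := {y | ∀ i < n, y i = x i}

end SymbolicSpace

/-! ## Inhomogeneous multinomial measures -/

/-- The measure on the four letters that gives mass `p i` to the letter `i`. -/
noncomputable def letterMeasure (p : Fin 4 → ℝ) : Measure (Fin 4) :=
  ∑ i, ENNReal.ofReal (p i) • Measure.dirac i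

/-- The position `j` lies in a block `T (2k-1) ≤ j < T (2k)` for some `k ≥ 1`. -/
def InOddBlock (T : ℕ → ℕ) (j : ℕ) : Prop :=
  ∃ k, 1 ≤ k ∧ T (2 * k - 1) ≤ j ∧ j < T (2 * k)

open scoped Classical in
/-- The weights of the letter at position `j`: `a` in the odd blocks and `b` in the others. -/
noncomputable def blockWeights (T : ℕ → ℕ) (a b : Fin 4 → ℝ) (j : ℕ) : Fin 4 → ℝ :=
  if InOddBlock T j then a else b

/-- The inhomogeneous multinomial measure: the letters are independent and the letter at position
`j ≥ 1` has weights `blockWeights T a b j`. -/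
noncomputable def inhomMeasure (T : ℕ → ℕ) (a b : Fin 4 → ℝ) : Measure SymbolicSpace :=
  Measure.infinitePi (fun i : ℕ => letterMeasure (blockWeights T a b (i + 1)))

/-- The mass of a cylinder is the product of the weights of its letters. -/
lemma inhomMeasure_cyl (T : ℕ → ℕ) (a b : Fin 4 → ℝ) (ha : ∀ i, 0 < a i) (hb : ∀ i, 0 < b i)
    (hasum : ∑ i, a i = 1) (hbsum : ∑ i, b i = 1) (x : SymbolicSpace) (n : ℕ) :
    inhomMeasure T a b (SymbolicSpace.cyl x n) =
      ENNReal.ofReal (∏ i ∈ Finset.range n, blockWeights T a b (i + 1) (x i)) := by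
  classical
  have hpos : ∀ j i, 0 < blockWeights T a b j i := by
    intro j i; unfold blockWeights; split_ifs <;> simp [ha, hb]
  have hone : ∀ j, ∑ i, blockWeights T a b j i = 1 := by
    intro j; unfold blockWeights; split_ifs <;> assumption
  have : ∀ i : ℕ, IsProbabilityMeasure (letterMeasure (blockWeights T a b (i + 1))) := by
    intro i
    constructor
    simp only [letterMeasure, Measure.coe_finsetSum, Finset.sum_apply, Measure.smul_apply,
      measure_univ, smul_eq_mul, mul_one]
    rw [← ENNReal.ofReal_sum_of_nonneg (fun k _ => (hpos _ k).le), hone, ENNReal.ofReal_one]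
  have hset : SymbolicSpace.cyl x n =
      Set.pi (Finset.range n : Set ℕ) (fun i => ({x i} : Set (Fin 4))) := by
    ext y; simp [SymbolicSpace.cyl, Set.mem_pi]
  rw [hset, inhomMeasure, Measure.infinitePi_pi _ (fun i _ => MeasurableSet.singleton _),
    ENNReal.ofReal_prod_of_nonneg (fun i _ => (hpos _ _).le)]
  refine Finset.prod_congr rfl fun i _ => ?_
  simp [letterMeasure, Set.indicator_apply]

/-- The function `q ↦ log (p₁ ^ q + p₂ ^ q + p₃ ^ q + p₄ ^ q)`. -/
noncomputable def theta (p : Fin 4 → ℝ) (q : ℝ) : ℝ := Real.log (∑ i, p i ^ q)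

end OlsenMultifractal

namespace OlsenMultifractal

/-! ## Comparison of power sums of two interlacing vectors -/

section PowerSums

/-! Write $\tau_p(q)=\log_4\sum_i p_i^q$. Two facts of different nature are combined:
$\tau_b\le\tau_a$ on all of $\mathbb R$, and a multifractal analysis valid for any alternation of
two weight vectors with $\tau_b\le\tau_a$.

The inequality (`sum_rpow_le`). The hypotheses at $q=0$ and $q=1$, with $\sum a_i=\sum b_i$, say
that $\sum F(a_i)=\sum F(b_i)$ for every $F$ in the span of $x$, $\log x$, $x\log x$. Elements of
the span with two prescribed critical points rule out every order except
$a_1<b_1<b_2<a_2<a_3<b_3<b_4<a_4$ (`interlacing`). Adding $x^q$ to the span allows three prescribed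
critical points, at $b_1$, $a_2$, $b_3$; the resulting $F$ satisfies $F(b_i)<F(a_i)$ for each $i$,
and $\sum F(a_i)-\sum F(b_i)=\sum a_i^q-\sum b_i^q$.

The analysis. Balls are cylinders, and $\mu$ is a product of weights $a$ on a set $O$ of positions
and $b$ off it. The Gibbs measure $\nu_q$, with weights proportional to $a^q$ and $b^q$, satisfies
$\nu_q(C)=\mu(C)^q4^{-s_n}$ on cylinders of length $n$, where $s_n$ adds $\tau_a(q)$ or $\tau_b(q)$
at each position. Always $n\tau_b(q)\le s_n\le n\tau_a(q)$, and since blocks grow superexponentially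
both bounds are nearly attained for infinitely many $n$. A packing sees the largest rate and a
covering the smallest, whence $B=\tau_a$ and $b=\tau_b$ (`olsenB_prodMeasure`,
`olsenb_prodMeasure`).

On $X(\alpha)$ the same sums bound the dimensions above by $\alpha q+\tau_b(q)$ and $\alpha
q+\tau_a(q)$. For the lower bounds (`dim_levelSet_ge`) two different parameters are used: $q$ on $O$
and $q'$ off it, the minimizers of $\alpha y+\tau_a(y)$ and $\alpha y+\tau_b(y)$. Both kinds of
letters then have mean exponent $\alpha$, so the law of large numbers puts the measure on
$X(\alpha)$, while their entropies are $\tau_a^*(\alpha)\ge\tau_b^*(\alpha)$, the packing and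
Hausdorff rates. -/

theorem lt_of_hasDerivAt_pos {f f' : ℝ → ℝ} {u v : ℝ} (huv : u < v)
    (hd : ∀ x ∈ Set.Icc u v, HasDerivAt f (f' x) x) (h : ∀ x ∈ Set.Ioo u v, 0 < f' x) :
    f u < f v := by
  obtain ⟨c, hc, he⟩ := exists_hasDerivAt_eq_slope f f' huv
    (fun x hx => (hd x hx).continuousAt.continuousWithinAt)
    (fun x hx => hd x (Set.Ioo_subset_Icc_self hx))
  have := h c hc
  rw [he, div_pos_iff_of_pos_right (sub_pos.2 huv)] at this
  linarith

theorem gt_of_hasDerivAt_neg {f f' : ℝ → ℝ} {u v : ℝ} (huv : u < v)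
    (hd : ∀ x ∈ Set.Icc u v, HasDerivAt f (f' x) x) (h : ∀ x ∈ Set.Ioo u v, f' x < 0) :
    f v < f u := by
  have := lt_of_hasDerivAt_pos (f := fun x => - f x) (f' := fun x => - f' x) huv
    (fun x hx => (hd x hx).neg) (fun x hx => neg_pos.2 (h x hx))
  linarith

/-- A strictly convex function with two zeros is positive outside and negative inside. -/
theorem strictConvexOn_sign {K : ℝ → ℝ} (hK : StrictConvexOn ℝ (Set.Ioi 0) K) {u v : ℝ}
    (hu : 0 < u) (huv : u < v) (hKu : K u = 0) (hKv : K v = 0) {x : ℝ} (hx : 0 < x) :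
    (x < u → 0 < K x) ∧ (u < x → x < v → K x < 0) ∧ (v < x → 0 < K x) := by
  -- Convexity at three points with denominators cleared; when two of the three values vanish it
  -- gives the sign of the third.
  have key : ∀ {p q r : ℝ}, 0 < p → p < q → q < r →
      (r - p) * K q < (r - q) * K p + (q - p) * K r := by
    intro p q r hp hpq hqr
    have h := hK.2 (show p ∈ Set.Ioi 0 from hp) (show r ∈ Set.Ioi 0 from by simp; linarith)
      (hpq.trans hqr).ne 
      (show 0 < (r - q) / (r - p) from div_pos (by linarith) (by linarith))
      (show 0 < (q - p) / (r - p) from div_pos (by linarith) (by linarith))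
      (by rw [← add_div, div_eq_one_iff_eq] <;> linarith)
    have hrp : 0 < r - p := by linarith
    have e : ((r - q) / (r - p)) • p + ((q - p) / (r - p)) • r = q := by
      simp only [smul_eq_mul]; field_simp; ring
    rw [e] at h
    have := mul_lt_mul_of_pos_left h hrp
    simp only [smul_eq_mul] at this
    calc _ < _ := this
      _ = _ := by field_simp
  refine ⟨fun h => ?_, fun h h' => ?_, fun h => ?_⟩
  · have := key hx h huv
    rw [hKu, hKv] at this
    by_contra hc
    nlinarith
  · have := key hu h h'
    rw [hKu, hKv] at this
    by_contra hc
    nlinarith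
  · have := key hu huv h
    rw [hKu, hKv] at this
    by_contra hc
    nlinarith

theorem strictConvexOn_mul_log_Ioi : StrictConvexOn ℝ (Set.Ioi 0) fun x => x * Real.log x :=
  Real.strictConvexOn_mul_log.subset Set.Ioi_subset_Ici_self (convex_Ioi 0)

/-- The factor $q(q-1)$ turns the second derivative into $(q(q-1))^2x^{q-2}$, positive whatever the
sign of $q(q-1)$. -/
theorem strictConvexOn_mul_rpow {q : ℝ} (h0 : q ≠ 0) (h1 : q ≠ 1) :
    StrictConvexOn ℝ (Set.Ioi 0) fun x => q * (q - 1) * x ^ q := by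
  have hd : ∀ p : ℝ, ∀ x ∈ Set.Ioi (0 : ℝ), HasDerivAt (fun x => x ^ p) (p * x ^ (p - 1)) x :=
    fun p x hx => Real.hasDerivAt_rpow_const (Or.inl (ne_of_gt hx))
  refine strictConvexOn_of_deriv2_pos (convex_Ioi 0)
    (fun x hx => ((hd q x hx).const_mul _).continuousAt.continuousWithinAt) fun x hx => ?_
  rw [interior_Ioi] at hx
  have e : deriv^[2] (fun x : ℝ => q * (q - 1) * x ^ q) x
      = q * (q - 1) * (q * ((q - 1) * x ^ (q - 1 - 1))) := by
    simp only [Function.iterate_succ, Function.iterate_zero, Function.comp, id]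
    have : deriv (fun x : ℝ => q * (q - 1) * x ^ q) =ᶠ[𝓝 x]
        fun x => q * (q - 1) * (q * x ^ (q - 1)) := by
      filter_upwards [Ioi_mem_nhds hx] with y hy
      exact ((hd q y hy).const_mul _).deriv
    rw [this.deriv_eq]
    exact (((hd (q - 1) x hx).const_mul q).const_mul _).deriv
  rw [e]
  have h2 : 0 < x ^ (q - 1 - 1) := Real.rpow_pos_of_pos hx _
  have h3 : 0 < q * (q - 1) * (q * (q - 1)) :=
     mul_self_pos.2 (mul_ne_zero h0 (sub_ne_zero.2 h1))
  calc 0 < q * (q - 1) * (q * (q - 1)) * x ^ (q - 1 - 1) := mul_pos h3 h2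
    _ = _ := by ring

/-- The affine function that agrees with `g` at `u` and `v`. -/
noncomputable def chord (g : ℝ → ℝ) (u v x : ℝ) : ℝ :=
  (g v - g u) / (v - u) * x + (g u - (g v - g u) / (v - u) * u)

theorem chord_left (g : ℝ → ℝ) (u v : ℝ) : chord g u v u = g u := by
  unfold chord; ring

theorem chord_right (g : ℝ → ℝ) {u v : ℝ} (h : u < v) : chord g u v v = g v := by
  unfold chord
  have : v - u ≠ 0 := by linarith
  field_simp; ring

theorem strictConvexOn_sub_affine {g : ℝ → ℝ} {s : Set ℝ} (hg : StrictConvexOn ℝ s g) (m c : ℝ) :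
    StrictConvexOn ℝ s fun x => g x - (m * x + c) := by
  refine ⟨hg.1, fun x hx y hy hxy α β hα hβ hαβ => ?_⟩
  have := hg.2 hx hy hxy hα hβ hαβ
  simp only [smul_eq_mul] at *
  have e : c = (α + β) * c := by rw [hαβ, one_mul]
  nlinarith

/-- A combination of `x`, `log x` and `x log x` that increases up to `u`, decreases on `[u, v]` and
increases from `v` on. -/
theorem exists_combination {u v : ℝ} (hu : 0 < u) (huv : u < v) : ∃ A B : ℝ, ∃ F : ℝ → ℝ,
    (∀ x, F x = x * Real.log x + A * x + B * Real.log x) ∧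
    (∀ x y, 0 < x → x ≤ y → y ≤ u → F x ≤ F y) ∧ (∀ x y, 0 < x → x < y → y ≤ u → F x < F y) ∧
    (∀ x y, u ≤ x → x ≤ y → y ≤ v → F y ≤ F x) ∧ (∀ x y, v ≤ x → x ≤ y → F x ≤ F y) := by
  set g : ℝ → ℝ := fun x => x * Real.log x with hg
  set m := (g v - g u) / (v - u) with hm
  set c := g u - m * u with hc
  have hch : ∀ x, chord g u v x = m * x + c := fun x => rfl
  have hconv := strictConvexOn_sub_affine strictConvexOn_mul_log_Ioi m c
  have hsign : ∀ {x : ℝ}, 0 < x → _ := fun {x} hx => strictConvexOn_sign hconv hu huv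
    (by rw [← hch, chord_left, sub_self]) (by rw [← hch, chord_right g huv, sub_self]) hx
  -- The coefficients give $xF'(x)=x\log x-(mx+c)$, the gap between $x\log x$ and its chord over
  -- $[u,v]$; the $-1$ cancels the constant in $(x\log x)'$.
  set F : ℝ → ℝ := fun x => x * Real.log x + (-1 - m) * x + (-c) * Real.log x with hF
  have hd : ∀ x, 0 < x → HasDerivAt F ((x * Real.log x - (m * x + c)) / x) x := by
    intro x hx
    have h1 := Real.hasDerivAt_log hx.ne'
    have := (((hasDerivAt_id x).mul h1).add ((hasDerivAt_id x).const_mul (-1 - m))).add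
      (h1.const_mul (-c))
    refine HasDerivAt.congr_deriv this ?_
    simp only [id]; field_simp; ring
  have s1 : ∀ x y, 0 < x → x < y → y ≤ u → F x < F y := fun x y hx hxy hy =>
    lt_of_hasDerivAt_pos hxy (fun z hz => hd z (by linarith [hz.1])) fun z hz =>
      div_pos ((hsign (by linarith [hz.1])).1 (by linarith [hz.2])) (by linarith [hz.1])
  have s2 : ∀ x y, u ≤ x → x < y → y ≤ v → F y < F x := fun x y hx hxy hy =>
    gt_of_hasDerivAt_neg hxy (fun z hz => hd z (by linarith [hz.1])) fun z hz =>
      div_neg_of_neg_of_pos ((hsign (by linarith [hz.1])).2.1 (by linarith [hz.1])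
        (by linarith [hz.2])) (by linarith [hz.1])
  have s3 : ∀ x y, v ≤ x → x < y → F x < F y := fun x y hx hxy =>
    lt_of_hasDerivAt_pos hxy (fun z hz => hd z (by linarith [hz.1])) fun z hz =>
      div_pos ((hsign (by linarith [hz.1])).2.2 (by linarith [hz.1])) (by linarith [hz.1])
  refine ⟨_, _, F, fun x => rfl, fun x y hx hxy hy => ?_, s1, fun x y hx hxy hy => ?_,
    fun x y hx hxy => ?_⟩
  · rcases hxy.eq_or_lt with rfl | h
    exacts [le_rfl, (s1 _ _ hx h hy).le]
  · rcases hxy.eq_or_lt with rfl | h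
    exacts [le_rfl, (s2 _ _ hx h hy).le]
  · rcases hxy.eq_or_lt with rfl | h
    exacts [le_rfl, (s3 _ _ hx h).le]

variable {a b : Fin 4 → ℝ}

/-- Two increasing vectors with the same sum, the same product and the same entropy interlace. -/
theorem interlacing (ha : ∀ i, 0 < a i) (hb : ∀ i, 0 < b i)
    (hsum : ∑ i, a i = ∑ i, b i) (hlog : ∑ i, Real.log (a i) = ∑ i, Real.log (b i))
    (hent : ∑ i, a i * Real.log (a i) = ∑ i, b i * Real.log (b i))
    (hma : StrictMono a) (hmb : StrictMono b) (h0 : a 0 < b 0) :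
    b 1 < a 1 ∧ a 2 < b 2 ∧ b 3 < a 3 := by
  have a01 : a 0 < a 1 := hma (by decide)
  have a12 : a 1 < a 2 := hma (by decide)
  have a23 : a 2 < a 3 := hma (by decide)
  have b01 : b 0 < b 1 := hmb (by decide)
  have b12 : b 1 < b 2 := hmb (by decide)
  have b23 : b 2 < b 3 := hmb (by decide)
  -- $F$ has equal sums over `a` and `b`, and `F (a 0) < F (b 0)` because `b 0 ≤ u`; hence the three
  -- other comparisons cannot all go the same way.
  have key : ∀ u v : ℝ, b 0 ≤ u → u < v →
      (∀ F : ℝ → ℝ, (∀ x y, 0 < x → x ≤ y → y ≤ u → F x ≤ F y) →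
      (∀ x y, u ≤ x → x ≤ y → y ≤ v → F y ≤ F x) → (∀ x y, v ≤ x → x ≤ y → F x ≤ F y) →
      F (a 1) ≤ F (b 1) ∧ F (a 2) ≤ F (b 2) ∧ F (a 3) ≤ F (b 3)) → False := by
    intro u v hu huv h
    obtain ⟨A, B, F, hF, s1, s1', s2, s3⟩ := exists_combination ((hb 0).trans_le hu) huv
    obtain ⟨h1, h2, h3⟩ := h F s1 s2 s3
    have h0' := s1' (a 0) (b 0) (ha 0) h0 hu
    have e : ∑ i, F (a i) = ∑ i, F (b i) := by
      simp only [hF, Finset.sum_add_distrib, ← Finset.mul_sum, hsum, hlog, hent]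
    simp only [Fin.sum_univ_four] at e
    linarith
  have p1 := ha 1
  have p2 := ha 2
  have p3 := ha 3
  have c1 : b 1 < a 1 := by
    by_contra hc
    rw [not_lt] at hc
    -- In each case `u` and `v` put every pair `a i`, `b i` in one monotone stretch, increasing if
    -- `a i ≤ b i` and decreasing if `b i ≤ a i`. A bound with `+ 1` only pushes `v` beyond all the
    -- points.
    rcases le_total (a 2) (b 2) with h2 | h2 <;> rcases le_total (a 3) (b 3) with h3 | h3
    · refine key (b 3) (b 3 + 1) (by linarith) (by linarith) fun F s1 s2 s3 => ⟨?_, ?_, ?_⟩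
      all_goals apply s1 <;> linarith
    · refine key (b 3) (a 3 + 1) (by linarith) (by linarith) fun F s1 s2 s3 => ⟨?_, ?_, ?_⟩
      · apply s1 <;> linarith
      · apply s1 <;> linarith
      · apply s2 <;> linarith
    · refine key (b 2) (a 3) (by linarith) (by linarith) fun F s1 s2 s3 => ⟨?_, ?_, ?_⟩
      · apply s1 <;> linarith
      · apply s2 <;> linarith
      · apply s3 <;> linarith
    · refine key (b 2) (a 3) (by linarith) (by linarith) fun F s1 s2 s3 => ⟨?_, ?_, ?_⟩
      · apply s1 <;> linarith
      · apply s2 <;> linarith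
      · apply s2 <;> linarith
  have c2 : a 2 < b 2 := by
    by_contra hc
    rw [not_lt] at hc
    rcases le_total (a 3) (b 3) with h3 | h3
    · refine key (b 1) (a 3) (by linarith) (by linarith) fun F s1 s2 s3 => ⟨?_, ?_, ?_⟩
      · apply s2 <;> linarith
      · apply s2 <;> linarith
      · apply s3 <;> linarith
    · refine key (b 1) (a 3) (by linarith) (by linarith) fun F s1 s2 s3 => ⟨?_, ?_, ?_⟩
      all_goals apply s2 <;> linarith
  refine ⟨c1, c2, ?_⟩
  by_contra hc
  rw [not_lt] at hc
  refine key (b 1) (a 2) (by linarith) (by linarith) fun F s1 s2 s3 => ⟨?_, ?_, ?_⟩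
  · apply s2 <;> linarith
  · apply s3 <;> linarith
  · apply s3 <;> linarith

/-- A combination of `x ^ q`, `x`, `log x` and `x log x` with prescribed critical points. -/
theorem exists_rpow_combination {q : ℝ} (h0 : q ≠ 0) (h1 : q ≠ 1) {u v w : ℝ} (hu : 0 < u)
    (huv : u < v) (hvw : v < w) : ∃ A B C : ℝ, ∃ F : ℝ → ℝ,
    (∀ x, F x = x ^ q + A * x + B * Real.log x + C * (x * Real.log x)) ∧
    (∀ x y, 0 < x → x < y → y ≤ u → F y < F x) ∧ (∀ x y, u ≤ x → x < y → y ≤ v → F x < F y) ∧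
    (∀ x y, v ≤ x → x < y → y ≤ w → F y < F x) ∧ (∀ x y, w ≤ x → x < y → F x < F y) := by
  have huw := huv.trans hvw
  obtain ⟨A, B, C, hzu, hzv, hzw⟩ : ∃ A B C : ℝ,
      q * u ^ q + A * u + B + C * (u * Real.log u) = 0 ∧
      q * v ^ q + A * v + B + C * (v * Real.log v) = 0 ∧
      q * w ^ q + A * w + B + C * (w * Real.log w) = 0 := by
    set g : ℝ → ℝ := fun x => x * Real.log x with hg
    set m := (g w - g u) / (w - u) with hm
    set c := g u - m * u with hc
    have hch : ∀ x, chord g u w x = m * x + c := fun x => rfl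
    set g' : ℝ → ℝ := fun x => q * x ^ q with hg'
    set m' := (g' w - g' u) / (w - u) with hm'
    set c' := g' u - m' * u with hc'
    have hch' : ∀ x, chord g' u w x = m' * x + c' := fun x => rfl
    have eu := chord_left g u w
    have ew := chord_right g huw
    have eu' := chord_left g' u w
    have ew' := chord_right g' huw
    rw [hch] at eu ew
    rw [hch'] at eu' ew'
    have hneg : g v - (m * v + c) < 0 :=
      (strictConvexOn_sign (strictConvexOn_sub_affine strictConvexOn_mul_log_Ioi m c) hu huw
        (by rw [eu, sub_self]) (by rw [ew, sub_self]) (hu.trans huv)).2.1 huv hvw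
    -- Subtracting chords over $[u,w]$ settles the conditions at $u$ and $w$. The one at $v$ is met
    -- with the multiplier `l`, available because $x\log x$ lies strictly below its chord there.
    set l := (g' v - (m' * v + c')) / (g v - (m * v + c)) with hl
    have hlv : l * (g v - (m * v + c)) = g' v - (m' * v + c') := div_mul_cancel₀ _ hneg.ne
    refine ⟨-m' + l * m, -c' + l * c, -l, ?_, ?_, ?_⟩
    · linear_combination (-1 : ℝ) * eu' + l * eu
    · linear_combination (-1 : ℝ) * hlv
    · linear_combination (-1 : ℝ) * ew' + l * ew
  set h : ℝ → ℝ := fun x => q * x ^ (q - 1) + A + B * x⁻¹ + C * Real.log x with hh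
  have hx1 : ∀ x : ℝ, 0 < x → x ^ (q - 1) = x ^ q / x := fun x hx => Real.rpow_sub_one hx.ne' q
  have hzero : ∀ x, 0 < x → q * x ^ q + A * x + B + C * (x * Real.log x) = 0 → h x = 0 := by
    intro x hx e
    have : h x = (q * x ^ q + A * x + B + C * (x * Real.log x)) / x := by
      simp only [hh, hx1 x hx]; field_simp
    rw [this, e, zero_div]
  have hhu := hzero u hu hzu
  have hhv := hzero v (hu.trans huv) hzv
  have hhw := hzero w (hu.trans huw) hzw
  -- $K=x^2h'$ is strictly convex. Rolle between the three zeros of $h$ gives two zeros of $K$, so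
  -- $h$ rises, falls and rises, and its signs are $-,+,-,+$.
  set K : ℝ → ℝ := fun x => q * (q - 1) * x ^ q - ((-C) * x + B) with hK
  have hhd : ∀ x, 0 < x → HasDerivAt h (K x / x ^ 2) x := by
    intro x hx
    have h2 := (((Real.hasDerivAt_rpow_const (x := x) (p := q - 1) (Or.inl hx.ne')).const_mul
      q).add_const A).add ((hasDerivAt_inv hx.ne').const_mul B) |>.add
      ((Real.hasDerivAt_log hx.ne').const_mul C)
    refine HasDerivAt.congr_deriv h2 ?_
    simp only [hK, Real.rpow_sub_one hx.ne']
    field_simp; ring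
  have hKc : StrictConvexOn ℝ (Set.Ioi 0) K :=
    strictConvexOn_sub_affine (strictConvexOn_mul_rpow h0 h1) (-C) B
  have rolle : ∀ x y, 0 < x → x < y → h x = 0 → h y = 0 → ∃ z, x < z ∧ z < y ∧ K z = 0 := by
    intro x y hx hxy ex ey
    obtain ⟨z, hz, e⟩ := exists_hasDerivAt_eq_zero (f := h) (f' := fun x => K x / x ^ 2) hxy
      (fun z hz => (hhd z (by linarith [hz.1])).continuousAt.continuousWithinAt)
      (by rw [ex, ey]) (fun z hz => hhd z (by linarith [hz.1]))
    refine ⟨z, hz.1, hz.2, ?_⟩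
    have : z ^ 2 ≠ 0 := by have : 0 < z := by linarith [hz.1]
                           positivity
    exact (div_eq_zero_iff.1 e).resolve_right this
  obtain ⟨r, hur, hrv, hKr⟩ := rolle u v hu huv hhu hhv
  obtain ⟨s, hvs, hsw, hKs⟩ := rolle v w (hu.trans huv) hvw hhv hhw
  have hsign : ∀ {x : ℝ}, 0 < x → _ := fun {x} hx =>
    strictConvexOn_sign hKc (hu.trans hur) (hrv.trans hvs) hKr hKs hx
  have i1 : ∀ x y, 0 < x → x < y → y ≤ r → h x < h y := fun x y hx hxy hy =>
    lt_of_hasDerivAt_pos hxy (fun z hz => hhd z (by linarith [hz.1])) fun z hz =>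
      div_pos ((hsign (by linarith [hz.1])).1 (by linarith [hz.2]))
        (pow_pos (by linarith [hz.1]) 2)
  have i2 : ∀ x y, r ≤ x → x < y → y ≤ s → h y < h x := fun x y hx hxy hy =>
    gt_of_hasDerivAt_neg hxy (fun z hz => hhd z (by linarith [hz.1])) fun z hz =>
      div_neg_of_neg_of_pos ((hsign (by linarith [hz.1])).2.1 (by linarith [hz.1])
        (by linarith [hz.2])) (pow_pos (by linarith [hz.1]) 2)
  have i3 : ∀ x y, s ≤ x → x < y → h x < h y := fun x y hx hxy =>
    lt_of_hasDerivAt_pos hxy (fun z hz => hhd z (by linarith [hz.1])) fun z hz =>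
      div_pos ((hsign (by linarith [hz.1])).2.2 (by linarith [hz.1]))
        (pow_pos (by linarith [hz.1]) 2)
  have n1 : ∀ x, 0 < x → x < u → h x < 0 := fun x hx hxu => by
    have := i1 x u hx hxu hur.le; linarith
  have n2 : ∀ x, u < x → x < v → 0 < h x := fun x hx hxv => by
    rcases le_or_gt x r with hc | hc
    · have := i1 u x hu hx hc; linarith
    · have := i2 x v hc.le hxv hvs.le; linarith
  have n3 : ∀ x, v < x → x < w → h x < 0 := fun x hx hxw => by
    rcases le_or_gt x s with hc | hc
    · have := i2 v x hrv.le hx hc; linarith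
    · have := i3 x w hc.le hxw; linarith
  have n4 : ∀ x, w < x → 0 < h x := fun x hx => by
    have := i3 w x hsw.le hx; linarith
  set F : ℝ → ℝ := fun x => x ^ q + (A - C) * x + B * Real.log x + C * (x * Real.log x) with hF
  have hd : ∀ x, 0 < x → HasDerivAt F (h x) x := by
    intro x hx
    have h1 := Real.hasDerivAt_log hx.ne'
    have := (((Real.hasDerivAt_rpow_const (x := x) (p := q) (Or.inl hx.ne')).add
      ((hasDerivAt_id x).const_mul (A - C))).add (h1.const_mul B)).add
      (((hasDerivAt_id x).mul h1).const_mul C)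
    refine HasDerivAt.congr_deriv this ?_
    simp only [id, hh]; field_simp; ring
  refine ⟨_, _, _, F, fun x => rfl, fun x y hx hxy hy => ?_, fun x y hx hxy hy => ?_,
    fun x y hx hxy hy => ?_, fun x y hx hxy => ?_⟩
  · exact gt_of_hasDerivAt_neg hxy (fun z hz => hd z (by linarith [hz.1])) fun z hz =>
      n1 z (by linarith [hz.1]) (by linarith [hz.2])
  · exact lt_of_hasDerivAt_pos hxy (fun z hz => hd z (by linarith [hz.1])) fun z hz =>
      n2 z (by linarith [hz.1]) (by linarith [hz.2])
  · exact gt_of_hasDerivAt_neg hxy (fun z hz => hd z (by linarith [hz.1])) fun z hz =>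
      n3 z (by linarith [hz.1]) (by linarith [hz.2])
  · exact lt_of_hasDerivAt_pos hxy (fun z hz => hd z (by linarith [hz.1])) fun z hz =>
      n4 z (by linarith [hz.1])

/-- With critical points `b 0`, `a 1`, `b 2`, each pair lies in one monotone stretch of the test
function, directed so that `F (b i) < F (a i)`. At $q=0$ and $q=1$ the two power sums agree. -/
theorem sum_rpow_le_of_interlacing (ha : ∀ i, 0 < a i) (hb : ∀ i, 0 < b i)
    (hsum : ∑ i, a i = ∑ i, b i) (hlog : ∑ i, Real.log (a i) = ∑ i, Real.log (b i))
    (hent : ∑ i, a i * Real.log (a i) = ∑ i, b i * Real.log (b i))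
    (hma : StrictMono a) (hmb : StrictMono b)
    (h0 : a 0 < b 0) (h1 : b 1 < a 1) (h2 : a 2 < b 2) (h3 : b 3 < a 3) (q : ℝ) :
    ∑ i, b i ^ q ≤ ∑ i, a i ^ q := by
  rcases eq_or_ne q 0 with rfl | hq0
  · simp
  rcases eq_or_ne q 1 with rfl | hq1
  · simp [hsum]
  have a12 : a 1 < a 2 := hma (by decide)
  have b01 : b 0 < b 1 := hmb (by decide)
  have b23 : b 2 < b 3 := hmb (by decide)
  obtain ⟨A, B, C, F, hF, s1, s2, s3, s4⟩ := exists_rpow_combination hq0 hq1 (hb 0)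
    (b01.trans h1) (a12.trans h2)
  have k0 := s1 (a 0) (b 0) (ha 0) h0 le_rfl
  have k1 := s2 (b 1) (a 1) b01.le h1 le_rfl
  have k2 := s3 (a 2) (b 2) a12.le h2 le_rfl
  have k3 := s4 (b 3) (a 3) b23.le h3
  have e : ∑ i, F (a i) - ∑ i, F (b i) = ∑ i, a i ^ q - ∑ i, b i ^ q := by
    simp only [hF, Finset.sum_add_distrib, ← Finset.mul_sum, hsum, hlog, hent]
    ring
  rw [Fin.sum_univ_four, Fin.sum_univ_four] at e
  linarith

theorem hasDerivAt_theta {p : Fin 4 → ℝ} (hp : ∀ i, 0 < p i) (q : ℝ) :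
    HasDerivAt (theta p) ((∑ i, p i ^ q * Real.log (p i)) / ∑ i, p i ^ q) q := by
  have hpos : 0 < ∑ i, p i ^ q :=
    Finset.sum_pos (fun i _ => Real.rpow_pos_of_pos (hp i) q) Finset.univ_nonempty
  refine HasDerivAt.log ?_ hpos.ne'
  refine HasDerivAt.fun_sum fun i _ => ?_
  exact (Real.hasStrictDerivAt_const_rpow (hp i) q).hasDerivAt

/-- For a probability vector, $\theta'(0)$ is the mean of the logarithms and $\theta'(1)=\sum
p_i\log p_i$, so the hypotheses are the moment identities that interlacing needs. -/
theorem sum_rpow_le {a b : Fin 4 → ℝ} (ha : ∀ i, 0 < a i) (hb : ∀ i, 0 < b i)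
    (ha_sum : ∑ i, a i = 1) (hb_sum : ∑ i, b i = 1) (hma : StrictMono a) (hmb : StrictMono b)
    (h_theta0 : deriv (theta a) 0 = deriv (theta b) 0)
    (h_theta1 : deriv (theta a) 1 = deriv (theta b) 1) (hab : a 0 < b 0) :
    b 3 < a 3 ∧ ∀ q : ℝ, ∑ i, b i ^ q ≤ ∑ i, a i ^ q := by
  rw [(hasDerivAt_theta ha 0).deriv, (hasDerivAt_theta hb 0).deriv] at h_theta0
  rw [(hasDerivAt_theta ha 1).deriv, (hasDerivAt_theta hb 1).deriv] at h_theta1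
  simp only [Real.rpow_zero, one_mul, Real.rpow_one, ha_sum, hb_sum, div_one] at h_theta0 h_theta1
  have hlog : ∑ i, Real.log (a i) = ∑ i, Real.log (b i) := by
    have : (∑ _i : Fin 4, (1 : ℝ)) ≠ 0 := by simp
    exact (div_left_inj' this).1 h_theta0
  have hsum := ha_sum.trans hb_sum.symm
  obtain ⟨h1, h2, h3⟩ := interlacing ha hb hsum hlog h_theta1 hma hmb hab
  exact ⟨h3, sum_rpow_le_of_interlacing ha hb hsum hlog h_theta1 hma hmb hab h1 h2 h3⟩

end PowerSums

/-! ## Balls, coverings and packings of the symbolic space -/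

namespace SymbolicSpace

/-- The word formed by the first `n` letters of `x`. -/
def word (x : SymbolicSpace) (n : ℕ) : Fin n → Fin 4 := fun i => x i

/-- The radius `4 ^ (1 - n)` of the open balls that are the cylinders of length `n`. -/
noncomputable def radius (n : ℕ) : ℝ := 4 * (4 : ℝ) ^ (-(n : ℝ))

/-- The length of the cylinders that are the open balls of radius `r ≤ 1`. -/
noncomputable def level (r : ℝ) : ℕ := ⌊-Real.logb 4 r⌋₊ + 1

theorem radius_pos (n : ℕ) : 0 < radius n := by unfold radius; positivity

theorem rpow_neg_lt_radius (n : ℕ) : (4 : ℝ) ^ (-(n : ℝ)) < radius n := by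
  have : (0 : ℝ) < 4 ^ (-(n : ℝ)) := by positivity
  unfold radius; linarith

theorem radius_succ (n : ℕ) : radius (n + 1) = (4 : ℝ) ^ (-(n : ℝ)) := by
  unfold radius
  rw [Nat.cast_add, neg_add, Real.rpow_add (by norm_num)]
  norm_num
  rw [mul_comm, mul_assoc]; norm_num

theorem tendsto_radius : Tendsto radius atTop (𝓝 0) := by
  have h : Tendsto (fun n : ℕ => 4 * ((1 / 4 : ℝ)) ^ n) atTop (𝓝 (4 * 0)) :=
    (tendsto_pow_atTop_nhds_zero_of_lt_one (by norm_num) (by norm_num)).const_mul _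
  rw [mul_zero] at h
  refine h.congr fun n => ?_
  rw [radius, Real.rpow_neg (by norm_num), Real.rpow_natCast, one_div, inv_pow]

theorem level_spec {r : ℝ} (h0 : 0 < r) (h1 : r ≤ 1) :
    (4 : ℝ) ^ (-(level r : ℝ)) < r ∧ r ≤ radius (level r) := by
  have hl : 0 ≤ -Real.logb 4 r := by
    have := Real.logb_nonpos (b := 4) (by norm_num) h0.le h1
    linarith
  have e : (4 : ℝ) ^ (Real.logb 4 r) = r := Real.rpow_logb (by norm_num) (by norm_num) h0
  have f1 := Nat.floor_le hl
  have f2 := Nat.lt_floor_add_one (-Real.logb 4 r)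
  constructor
  · calc (4 : ℝ) ^ (-(level r : ℝ)) < (4 : ℝ) ^ (Real.logb 4 r) := by
          apply Real.rpow_lt_rpow_of_exponent_lt (by norm_num)
          simp only [level, Nat.cast_add, Nat.cast_one]; linarith
      _ = r := e
  · rw [level, radius_succ]
    calc r = (4 : ℝ) ^ (Real.logb 4 r) := e.symm
      _ ≤ _ := by
          apply Real.rpow_le_rpow_of_exponent_le (by norm_num)
          linarith

theorem lt_level {r : ℝ} (h0 : 0 < r) {m : ℕ} (hm : r ≤ (4 : ℝ) ^ (-(m : ℝ))) : m < level r := by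
  rw [level, Nat.lt_succ_iff]
  apply Nat.le_floor
  have := Real.logb_le_logb_of_le (b := 4) (by norm_num) h0 hm
  rw [Real.logb_rpow (by norm_num) (by norm_num)] at this
  linarith

theorem tendsto_level : Tendsto level (𝓝[>] 0) atTop := by
  rw [tendsto_atTop]
  intro m
  have : (0 : ℝ) < 4 ^ (-(m : ℝ)) := by positivity
  filter_upwards [Ioc_mem_nhdsGT this] with r hr
  exact (lt_level hr.1 hr.2).le

theorem word_eq_iff {x y : SymbolicSpace} {n : ℕ} : word y n = word x n ↔ y ∈ cyl x n :=
  ⟨fun h i hi => congrFun h ⟨i, hi⟩, fun h => funext fun i => h i i.2⟩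

theorem cyl_congr {x y : SymbolicSpace} {n : ℕ} (h : word y n = word x n) : cyl y n = cyl x n := by
  ext z; rw [← word_eq_iff, ← word_eq_iff, h]

theorem mem_cyl_self (x : SymbolicSpace) (n : ℕ) : x ∈ cyl x n := fun _ _ => rfl

theorem measurableSet_of_word {n : ℕ} {Y : Set SymbolicSpace}
    (h : ∀ x y, word x n = word y n → x ∈ Y → y ∈ Y) : MeasurableSet Y := by
  have hm : Measurable fun x : SymbolicSpace => word x n :=
    measurable_pi_lambda _ fun i => measurable_pi_apply _
  have e : Y = (fun x : SymbolicSpace => word x n) ⁻¹' ((fun x => word x n) '' Y) := by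
    ext y
    refine ⟨fun hy => ⟨y, hy, rfl⟩, ?_⟩
    rintro ⟨x, hx, hxy⟩
    exact h x y hxy hx
  rw [e]
  exact hm (Set.toFinite _).measurableSet

theorem dist_eq_of_ne {x y : SymbolicSpace} (h : x ≠ y) :
    dist x y = (4 : ℝ) ^ (-(PiNat.firstDiff (E := fun _ => Fin 4) x y : ℝ)) := by
  change wdist x y = _
  rw [wdist, if_neg h, Real.rpow_neg (by norm_num), Real.rpow_natCast]

theorem dist_le_of_mem_cyl {x y : SymbolicSpace} {n : ℕ} (h : y ∈ cyl x n) :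
    dist y x ≤ (4 : ℝ) ^ (-(n : ℝ)) := by
  rcases eq_or_ne y x with rfl | hne
  · rw [dist_self]; positivity
  rw [dist_eq_of_ne hne]
  apply Real.rpow_le_rpow_of_exponent_le (by norm_num)
  have := (PiNat.mem_cylinder_iff_le_firstDiff (E := fun _ => Fin 4) hne n).1 h
  have : (n : ℝ) ≤ PiNat.firstDiff (E := fun _ => Fin 4) y x := by exact_mod_cast this
  linarith

theorem mem_cyl_of_dist_lt {x y : SymbolicSpace} {n : ℕ} (h : dist y x < radius n) :
    y ∈ cyl x n := by
  rcases eq_or_ne y x with rfl | hne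
  · exact mem_cyl_self _ _
  refine (PiNat.mem_cylinder_iff_le_firstDiff (E := fun _ => Fin 4) hne n).2 ?_
  by_contra hc
  rw [not_le] at hc
  obtain ⟨m, rfl⟩ : ∃ m, n = m + 1 := ⟨n - 1, by omega⟩
  rw [radius_succ, dist_eq_of_ne hne] at h
  have := (Real.rpow_lt_rpow_left_iff (by norm_num : (1 : ℝ) < 4)).1 h
  have h2 : (m : ℝ) < PiNat.firstDiff (E := fun _ => Fin 4) y x := by linarith
  have : m < PiNat.firstDiff (E := fun _ => Fin 4) y x := by exact_mod_cast h2
  omega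

theorem ball_eq_cyl {x : SymbolicSpace} {n : ℕ} {r : ℝ} (h1 : (4 : ℝ) ^ (-(n : ℝ)) < r)
    (h2 : r ≤ radius n) : Metric.ball x r = cyl x n := by
  ext y
  exact ⟨fun h => mem_cyl_of_dist_lt ((Metric.mem_ball.1 h).trans_le h2),
    fun h => Metric.mem_ball.2 ((dist_le_of_mem_cyl h).trans_lt h1)⟩

theorem ball_radius (x : SymbolicSpace) (n : ℕ) : Metric.ball x (radius n) = cyl x n :=
  ball_eq_cyl (rpow_neg_lt_radius n) le_rfl

theorem ball_eq_cyl_level {x : SymbolicSpace} {r : ℝ} (h0 : 0 < r) (h1 : r ≤ 1) :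
    Metric.ball x r = cyl x (level r) :=
  ball_eq_cyl (level_spec h0 h1).1 (level_spec h0 h1).2

/-! ### Packings and coverings compared with sums over words -/

theorem exists_section (E : Set SymbolicSpace) (n : ℕ) :
    ∃ f : ((fun x => word x n) '' E : Set (Fin n → Fin 4)) → SymbolicSpace,
      ∀ u, f u ∈ E ∧ word (f u) n = u :=
  ⟨fun u => u.2.choose, fun u => u.2.choose_spec⟩

/-- Disjoint balls are distinct cylinders, so a packing injects into the set of all finite words. -/
theorem prePackingAt_le {w : SymbolicSpace × ℝ → ℝ≥0∞} {E : Set SymbolicSpace} {δ : ℝ} (hδ : δ ≤ 1)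
    (G : ∀ n, (Fin n → Fin 4) → ℝ≥0∞)
    (h : ∀ x ∈ E, ∀ r, 0 < r → r < δ → w (x, r) ≤ G (level r) (word x (level r))) :
    prePackingAt w δ E ≤ ∑' n, ∑ u, G n u := by
  refine iSup₂_le fun S hS => ?_
  set φ : S → Σ n, (Fin n → Fin 4) := fun p => ⟨level p.1.2, word p.1.1 (level p.1.2)⟩ with hφ
  have hball : ∀ p ∈ S, Metric.ball p.1 p.2 = cyl p.1 (level p.2) := fun p hp =>
    ball_eq_cyl_level (hS.2.1 p hp).2.1 ((hS.2.1 p hp).2.2.le.trans hδ)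
  have hinj : Function.Injective φ := by
    rintro ⟨⟨x, r⟩, hp⟩ ⟨⟨y, s⟩, hq⟩ he
    by_contra hne
    have hd := hS.2.2 hp hq (fun hc => hne (Subtype.ext hc))
    simp only [Function.onFun] at hd
    rw [hball _ hp, hball _ hq] at hd
    simp only [hφ, Sigma.mk.injEq] at he
    obtain ⟨h1, h2⟩ := he
    rw [h1] at h2 hd
    rw [cyl_congr (eq_of_heq h2)] at hd
    exact Set.disjoint_left.1 hd (mem_cyl_self _ _) (mem_cyl_self _ _)
  calc ∑' p : S, w p ≤ ∑' p : S, (fun q : Σ n, (Fin n → Fin 4) => G q.1 q.2) (φ p) :=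
        ENNReal.tsum_le_tsum fun p =>
          h p.1.1 (hS.2.1 p p.2).1 p.1.2 (hS.2.1 p p.2).2.1 (hS.2.1 p p.2).2.2
    _ ≤ ∑' q : Σ n, (Fin n → Fin 4), G q.1 q.2 := ENNReal.tsum_comp_le_tsum_of_injective hinj _
    _ = ∑' n, ∑ u, G n u := by
        rw [ENNReal.tsum_sigma']
        exact tsum_congr fun n => tsum_fintype _

theorem tsum_ite_le (f : ℕ → ℝ≥0∞) (m : ℕ) :
    ∑' n, (if m ≤ n then f n else 0) = ∑' i, f (i + m) := by
  rw [← Summable.sum_add_tsum_nat_add' (f := fun n => if m ≤ n then f n else 0) (k := m)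
    ENNReal.summable, Finset.sum_eq_zero, zero_add]
  · exact tsum_congr fun i => if_pos (Nat.le_add_left m i)
  · exact fun i hi => if_neg (not_le.2 (Finset.mem_range.1 hi))

/-- Balls of radius below $4^{-m}$ are cylinders longer than $m$; a packing by them is bounded by a
tail of a convergent series. -/
theorem prePacking_eq_zero {w : SymbolicSpace × ℝ → ℝ≥0∞} {E : Set SymbolicSpace} {N : ℕ}
    (G : ∀ n, (Fin n → Fin 4) → ℝ≥0∞) (f : ℕ → ℝ≥0∞) (hf : ∑' n, f n ≠ ∞)
    (hG : ∀ n, N ≤ n → ∑ u, G n u ≤ f n)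
    (h : ∀ x ∈ E, ∀ r, 0 < r → r ≤ 1 → N ≤ level r → w (x, r) ≤ G (level r) (word x (level r))) :
    prePacking w E = 0 := by
  refine le_antisymm ?_ zero_le
  refine ge_of_tendsto (ENNReal.tendsto_sum_nat_add f hf) ?_
  filter_upwards [eventually_ge_atTop N] with m hm
  obtain ⟨δ, hδ⟩ : ∃ δ : ℝ, δ = (4 : ℝ) ^ (-(m : ℝ)) := ⟨_, rfl⟩
  have h4 : 0 < δ := by rw [hδ]; positivity
  have h41 : δ ≤ 1 := by
    rw [hδ]
    exact Real.rpow_le_one_of_one_le_of_nonpos (by norm_num) (by simp)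
  obtain ⟨G', hG'⟩ : ∃ G' : ∀ n, (Fin n → Fin 4) → ℝ≥0∞,
    ∀ n u, G' n u = if m ≤ n then G n u else 0 := ⟨fun n u => if m ≤ n then G n u else 0,
      fun n u => rfl⟩
  have k1 : prePackingAt w δ E ≤ ∑' n, ∑ u, G' n u := by
    refine prePackingAt_le h41 _ fun x hx r hr hr' => ?_
    have hlt := lt_level hr (hr'.le.trans hδ.le)
    rw [hG', if_pos hlt.le]
    exact h x hx r hr (hr'.le.trans h41) (hm.trans hlt.le)
  have k2 : ∑' n, ∑ u, G' n u ≤ ∑' n, (if m ≤ n then f n else 0) := by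
    refine ENNReal.tsum_le_tsum fun n => ?_
    simp only [hG']
    split_ifs with hn
    · exact hG n (hm.trans hn)
    · simp
  rw [tsum_ite_le] at k2
  exact (iInf₂_le _ h4).trans (k1.trans k2)

/-- The cylinders of length $n$ that meet `E`, each centred at a point of `E`, are at once a packing
and a covering of `E`. -/
theorem le_prePackingAt {w : SymbolicSpace × ℝ → ℝ≥0∞} {E : Set SymbolicSpace} {δ : ℝ} {n : ℕ}
    (hn : radius n < δ) (ν : Measure SymbolicSpace) (M : ℝ≥0∞)
    (h : ∀ x ∈ E, M * ν (cyl x n) ≤ w (x, radius n)) : M * ν E ≤ prePackingAt w δ E := by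
  obtain ⟨f, hf⟩ := exists_section E n
  have hinj : Function.Injective fun u => (f u, radius n) := fun u v huv => by
    have : f u = f v := (Prod.ext_iff.1 huv).1
    exact Subtype.ext (by rw [← (hf u).2, ← (hf v).2, this])
  have hS : IsPacking δ E (Set.range fun u => (f u, radius n)) := by
    refine ⟨Set.countable_range _, ?_, ?_⟩
    · rintro _ ⟨u, rfl⟩
      exact ⟨(hf u).1, radius_pos n, hn⟩
    · rintro _ ⟨u, rfl⟩ _ ⟨v, rfl⟩ hne
      simp only [Function.onFun, ball_radius]
      refine Set.disjoint_left.2 fun z hz hz' => hne ?_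
      have : word (f u) n = word (f v) n := by rw [← word_eq_iff.2 hz, word_eq_iff.2 hz']
      rw [(hf u).2, (hf v).2] at this
      rw [Subtype.ext this]
  refine le_trans ?_ (le_iSup₂ (f := fun (S : Set (SymbolicSpace × ℝ)) _ => ∑' p : S, w p) _ hS)
  rw [tsum_range (g := fun u => (f u, radius n)) (fun p => w p) hinj]
  calc M * ν E ≤ M * ν (⋃ u, cyl (f u) n) := by
        gcongr
        intro x hx
        refine Set.mem_iUnion.2 ⟨⟨word x n, x, hx, rfl⟩, word_eq_iff.1 ?_⟩
        rw [(hf _).2]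
    _ ≤ M * ∑' u, ν (cyl (f u) n) := by gcongr; exact measure_iUnion_le _
    _ = ∑' u, M * ν (cyl (f u) n) := ENNReal.tsum_mul_left.symm
    _ ≤ _ := ENNReal.tsum_le_tsum fun u => h _ (hf u).1

/-- Some `U i ∩ Y K` has positive outer mass, and at each scale a single good length bounds its
premeasure below. This is why infinitely many lengths suffice. -/
theorem packing_eq_top {w : SymbolicSpace × ℝ → ℝ≥0∞} {E : Set SymbolicSpace}
    (ν : Measure SymbolicSpace) (Y : ℕ → Set SymbolicSpace) (hE : ν (E ∩ ⋃ K, Y K) ≠ 0)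
    (h : ∀ K, ∀ M : ℕ, ∃ᶠ n in atTop, ∀ x ∈ Y K, (M : ℝ≥0∞) * ν (cyl x n) ≤ w (x, radius n)) :
    packing w E = ∞ := by
  refine eq_top_iff.2 (le_iInf₂ fun U hU => ?_)
  obtain ⟨i, K, hiK⟩ : ∃ i K, ν (U i ∩ Y K) ≠ 0 := by
    by_contra hc
    push Not at hc
    refine hE (measure_mono_null ?_ (measure_iUnion_null fun i => measure_iUnion_null (hc i)))
    rintro x ⟨hx, hx'⟩
    obtain ⟨i, hi⟩ := Set.mem_iUnion.1 (hU hx)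
    obtain ⟨K, hK⟩ := Set.mem_iUnion.1 hx'
    exact Set.mem_iUnion.2 ⟨i, Set.mem_iUnion.2 ⟨K, hi, hK⟩⟩
  have htop : prePacking w (U i) = ∞ := by
    have hM : ∀ M : ℕ, (M : ℝ≥0∞) * ν (U i ∩ Y K) ≤ prePacking w (U i) := by
      intro M
      refine le_iInf₂ fun δ hδ => ?_
      obtain ⟨n, hn, hnδ⟩ := ((h K M).and_eventually (tendsto_radius.eventually_lt_const hδ)).exists
      refine (le_prePackingAt hnδ ν M fun x hx => hn x hx.2).trans ?_
      refine iSup₂_le fun S hS => le_iSup₂ (f := fun (S : Set (SymbolicSpace × ℝ)) _ => ∑' p : S, w p) S ?_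
      exact ⟨hS.1, fun p hp => ⟨(hS.2.1 p hp).1.1, (hS.2.1 p hp).2⟩, hS.2.2⟩
    have ht : Tendsto (fun M : ℕ => (M : ℝ≥0∞) * ν (U i ∩ Y K)) atTop
        (𝓝 (∞ * ν (U i ∩ Y K))) :=
      ENNReal.Tendsto.mul_const ENNReal.tendsto_nat_nhds_top (Or.inl ENNReal.top_ne_zero)
    rw [ENNReal.top_mul hiK] at ht
    exact top_le_iff.1 (le_of_tendsto' ht hM)
  exact htop ▸ ENNReal.le_tsum i

/-- One length below $\delta$ already gives a covering, so smallness along infinitely many lengths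
is enough. Centres are chosen in each subset `F`, as the supremum over `F` requires. -/
theorem centeredHausdorff_eq_zero {w : SymbolicSpace × ℝ → ℝ≥0∞} {E : Set SymbolicSpace}
    (G : ∀ n, (Fin n → Fin 4) → ℝ≥0∞)
    (hG : ∀ ε : ℝ≥0∞, 0 < ε → ∃ᶠ n in atTop, ∑ u, G n u ≤ ε)
    (h : ∀ x ∈ E, ∀ n, w (x, radius n) ≤ G n (word x n)) : centeredHausdorff w E = 0 := by
  refine le_antisymm ?_ zero_le
  refine iSup₂_le fun F hF => iSup₂_le fun δ hδ => ?_
  refine le_of_forall_gt_imp_ge_of_dense fun ε hε => ?_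
  obtain ⟨n, hn, hnδ⟩ := ((hG ε hε).and_eventually
    (tendsto_radius.eventually_lt_const hδ)).exists
  obtain ⟨f, hf⟩ := exists_section F n
  have hinj : Function.Injective fun u => (f u, radius n) := fun u v huv => by
    have : f u = f v := (Prod.ext_iff.1 huv).1
    exact Subtype.ext (by rw [← (hf u).2, ← (hf v).2, this])
  have hS : IsCenteredCovering δ F (Set.range fun u => (f u, radius n)) := by
    refine ⟨Set.countable_range _, ?_, fun x hx => ?_⟩
    · rintro _ ⟨u, rfl⟩
      exact ⟨(hf u).1, radius_pos n, hnδ⟩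
    · refine Set.mem_biUnion ⟨⟨word x n, x, hx, rfl⟩, rfl⟩ ?_
      rw [ball_radius]
      exact word_eq_iff.1 (by rw [(hf _).2])
  refine (iInf₂_le _ hS).trans (le_trans ?_ hn)
  rw [tsum_range (g := fun u => (f u, radius n)) (fun p => w p) hinj]
  calc _ ≤ ∑' u : ((fun x => word x n) '' F : Set (Fin n → Fin 4)), G n u :=
        ENNReal.tsum_le_tsum fun u => by
          have := h _ (hF (hf u).1) n
          rwa [(hf u).2] at this
    _ ≤ ∑' u, G n u := ENNReal.tsum_comp_le_tsum_of_injective Subtype.val_injective _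
    _ = _ := tsum_fintype _

/-- Mass distribution: a covering carries at least the mass of `E`. An arbitrary covering mixes
radii, so the bound is needed on every small ball. -/
theorem centeredHausdorff_eq_top {X : Type*} [MetricSpace X] [MeasurableSpace X]
    {w : X × ℝ → ℝ≥0∞} {E : Set X} (ν : Measure X) (hE : ν E ≠ 0)
    (h : ∀ M : ℕ, ∃ δ : ℝ, 0 < δ ∧ ∀ x r, 0 < r → r < δ →
      (M : ℝ≥0∞) * ν (Metric.ball x r) ≤ w (x, r)) : centeredHausdorff w E = ∞ := by
  have hM : ∀ M : ℕ, (M : ℝ≥0∞) * ν E ≤ centeredHausdorff w E := by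
    intro M
    obtain ⟨δ, hδ, hw⟩ := h M
    refine le_trans ?_ (le_iSup₂ (f := fun F _ => preHausdorff w F) E subset_rfl)
    refine le_trans ?_ (le_iSup₂ (f := fun δ _ => preHausdorffAt w δ E) δ hδ)
    refine le_iInf₂ fun S hS => ?_
    have := hS.1.to_subtype
    calc (M : ℝ≥0∞) * ν E ≤ M * ν (⋃ p : S, Metric.ball p.1.1 p.1.2) := by
          gcongr
          rw [Set.iUnion_coe_set]
          exact hS.2.2
      _ ≤ M * ∑' p : S, ν (Metric.ball p.1.1 p.1.2) := by gcongr; exact measure_iUnion_le _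
      _ = ∑' p : S, (M : ℝ≥0∞) * ν (Metric.ball p.1.1 p.1.2) := ENNReal.tsum_mul_left.symm
      _ ≤ _ := ENNReal.tsum_le_tsum fun p =>
          hw _ _ (hS.2.1 p p.2).2.1 (hS.2.1 p p.2).2.2
  have ht : Tendsto (fun M : ℕ => (M : ℝ≥0∞) * ν E) atTop (𝓝 (∞ * ν E)) :=
    ENNReal.Tendsto.mul_const ENNReal.tendsto_nat_nhds_top (Or.inl ENNReal.top_ne_zero)
  rw [ENNReal.top_mul hE] at ht
  exact top_le_iff.1 (le_of_tendsto' ht hM)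

theorem ediam_cyl_le (x : SymbolicSpace) (n : ℕ) :
    Metric.ediam (cyl x n) ≤ ENNReal.ofReal ((4 : ℝ) ^ (-(n : ℝ))) := by
  refine Metric.ediam_le fun y hy z hz => ?_
  rw [edist_dist]
  refine ENNReal.ofReal_le_ofReal (dist_le_of_mem_cyl ?_)
  rw [← word_eq_iff] at *
  rw [hy, hz]

theorem hausdorffMeasure_eq_zero {E : Set SymbolicSpace} {t : ℝ} (ht : 0 ≤ t) {N : ℕ}
    (G : ∀ n, (Fin n → Fin 4) → ℝ≥0∞)
    (hG : ∀ ε : ℝ≥0∞, 0 < ε → ∃ᶠ n in atTop, ∑ u, G n u ≤ ε)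
    (h : ∀ x ∈ E, ∀ n, N ≤ n → ENNReal.ofReal ((4 : ℝ) ^ (-(n : ℝ) * t)) ≤ G n (word x n)) :
    Measure.hausdorffMeasure t E = 0 := by
  classical
  refine le_antisymm ?_ zero_le
  choose f hf using exists_section E
  have : ∀ n, Fintype ((fun x => word x n) '' E : Set (Fin n → Fin 4)) := fun n =>
    Fintype.ofFinite _
  have hr : Tendsto (fun n : ℕ => ENNReal.ofReal ((4 : ℝ) ^ (-(n : ℝ)))) atTop (𝓝 0) := by
    have h1 := ENNReal.tendsto_ofReal ((tendsto_add_atTop_iff_nat 1).2 tendsto_radius)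
    rw [ENNReal.ofReal_zero] at h1
    exact h1.congr fun n => by rw [radius_succ]
  refine (Measure.hausdorffMeasure_le_liminf_sum t E (l := atTop) _ hr
    (fun n u => cyl (f n u) n) (Eventually.of_forall fun n u => ediam_cyl_le _ _)
    (Eventually.of_forall fun n x hx => ?_)).trans ?_
  · refine Set.mem_iUnion.2 ⟨⟨word x n, x, hx, rfl⟩, word_eq_iff.1 ?_⟩
    rw [(hf n _).2]
  refine le_of_forall_gt_imp_ge_of_dense fun ε hε => ?_
  refine liminf_le_of_frequently_le' (((hG ε hε).and_eventually
    (eventually_ge_atTop N)).mono fun n hn => le_trans ?_ hn.1)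
  calc _ ≤ ∑ u : ((fun x => word x n) '' E : Set (Fin n → Fin 4)), G n u := by
        refine Finset.sum_le_sum fun u _ => ?_
        have := h _ (hf n u).1 n hn.2
        rw [(hf n u).2] at this
        refine le_trans ?_ this
        rw [Real.rpow_mul (by norm_num), ← ENNReal.ofReal_rpow_of_pos (by positivity)]
        exact ENNReal.rpow_le_rpow (ediam_cyl_le _ _) ht
    _ = ∑' u : ((fun x => word x n) '' E : Set (Fin n → Fin 4)), G n u := (tsum_fintype _).symm
    _ ≤ ∑' u, G n u := ENNReal.tsum_comp_le_tsum_of_injective Subtype.val_injective _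
    _ = _ := tsum_fintype _

/-- Mass distribution for arbitrary covering sets: the trace on `Y` of a set of small diameter $d>0$
lies in a cylinder of length $n$ with $4^{-(n+1)}<d$, hence the exponent $n+1$. -/
theorem le_dimH_of_measure_cyl_le {E Y : Set SymbolicSpace} (ν : Measure SymbolicSpace) {t : ℝ≥0}
    (hY : MeasurableSet Y) (hE : ν (E ∩ Y) ≠ 0) {N : ℕ}
    (h : ∀ x ∈ Y, ∀ n, N ≤ n →
      ν (cyl x n) ≤ ENNReal.ofReal ((4 : ℝ) ^ (-((n : ℝ) + 1) * t))) : (t : ℝ≥0∞) ≤ dimH E := by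
  rcases eq_or_ne t 0 with rfl | ht
  · simp
  have ht' : (0 : ℝ) < t := by
    have := pos_iff_ne_zero.2 ht
    exact_mod_cast this
  have hle : ν.restrict Y ≤ Measure.hausdorffMeasure (t : ℝ) := by
    refine Measure.le_hausdorffMeasure _ _
      (ENNReal.ofReal ((4 : ℝ) ^ (-((N + 1 : ℕ) : ℝ)))) (ENNReal.ofReal_pos.2 (by positivity))
      fun s hs => ?_
    rw [Measure.restrict_apply' hY]
    rcases Set.eq_empty_or_nonempty (s ∩ Y) with he | ⟨x, hxs, hxY⟩
    · rw [he]; simp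
    have hsub : ∀ n, Metric.ediam s < ENNReal.ofReal (radius n) → s ∩ Y ⊆ cyl x n := by
      rintro n hn y ⟨hy, -⟩
      refine mem_cyl_of_dist_lt ?_
      have := (Metric.edist_le_ediam_of_mem hy hxs).trans_lt hn
      rw [edist_dist] at this
      exact (ENNReal.ofReal_lt_ofReal_iff (radius_pos n)).1 this
    -- A set of diameter zero has its trace in cylinders of every length, whose masses tend to $0$.
    rcases eq_or_ne (Metric.ediam s) 0 with h0 | h0
    · rw [h0, ENNReal.zero_rpow_of_pos ht']
      have hlim : Tendsto (fun n : ℕ => ENNReal.ofReal ((4 : ℝ) ^ (-((n : ℝ) + 1) * t))) atTop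
          (𝓝 0) := by
        rw [← ENNReal.ofReal_zero]
        refine ENNReal.tendsto_ofReal ?_
        have h1 : Tendsto (fun n : ℕ => (n : ℝ) + 1) atTop atTop :=
          tendsto_atTop_add_const_right _ _ tendsto_natCast_atTop_atTop
        have := (tendsto_rpow_atBot_of_base_gt_one (4 : ℝ) (by norm_num)).comp
          (tendsto_neg_atTop_atBot.comp (h1.atTop_mul_const ht'))
        exact this.congr fun n => by simp only [Function.comp, neg_mul]
      refine ge_of_tendsto hlim ?_
      filter_upwards [eventually_ge_atTop N] with n hn
      refine (measure_mono (hsub n ?_)).trans (h x hxY n hn)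
      rw [h0]
      exact ENNReal.ofReal_pos.2 (radius_pos n)
    · have hfin : Metric.ediam s ≠ ∞ := ne_top_of_le_ne_top ENNReal.ofReal_ne_top hs
      set d := (Metric.ediam s).toReal with hd
      have hds : Metric.ediam s = ENNReal.ofReal d := (ENNReal.ofReal_toReal hfin).symm
      have hd0 : 0 < d := ENNReal.toReal_pos h0 hfin
      have hdN : d ≤ (4 : ℝ) ^ (-((N + 1 : ℕ) : ℝ)) := by
        rw [hds] at hs
        exact (ENNReal.ofReal_le_ofReal_iff (by positivity)).1 hs
      have hd1 : d ≤ 1 := hdN.trans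
        (Real.rpow_le_one_of_one_le_of_nonpos (by norm_num) (by
          have : (0 : ℝ) ≤ ((N + 1 : ℕ) : ℝ) := Nat.cast_nonneg _
          linarith))
      have hlev := lt_level hd0 hdN
      -- One letter is given up, because $d$ may equal `radius (level d)` while the inclusion in a
      -- cylinder needs a strict inequality.
      obtain ⟨m, hm⟩ : ∃ m, level d = m + 1 := ⟨level d - 1, by omega⟩
      have hsp := level_spec hd0 hd1
      rw [hm] at hsp hlev
      refine (measure_mono (hsub m ?_)).trans ((h x hxY m (by omega)).trans ?_)
      · rw [hds]
        refine (ENNReal.ofReal_lt_ofReal_iff (radius_pos m)).2 (hsp.2.trans_lt ?_)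
        rw [radius_succ]
        exact rpow_neg_lt_radius m
      · rw [hds, ENNReal.ofReal_rpow_of_pos hd0]
        refine ENNReal.ofReal_le_ofReal ?_
        rw [Real.rpow_mul (by norm_num)]
        have := hsp.1.le
        push_cast at this
        exact Real.rpow_le_rpow (by positivity) this t.2
  refine le_dimH_of_hausdorffMeasure_ne_zero fun h0 => hE ?_
  have h1 : (ν.restrict Y) E = 0 := le_antisymm ((hle E).trans h0.le) zero_le
  rwa [Measure.restrict_apply' hY] at h1

/-! ### Local exponents read on cylinders -/

theorem mem_support {μ : Measure SymbolicSpace} (hμ : ∀ x n, 0 < μ (cyl x n))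
    (x : SymbolicSpace) : x ∈ μ.support := by
  rw [Measure.mem_support_iff_forall]
  intro U hU
  obtain ⟨ε, hε, hs⟩ := Metric.mem_nhds_iff.1 hU
  obtain ⟨n, hn⟩ := (tendsto_radius.eventually_lt_const hε).exists
  refine (hμ x n).trans_le (measure_mono (subset_trans ?_ hs))
  rw [← ball_radius]
  exact Metric.ball_subset_ball hn.le

/-- The level of a ball is asymptotic to $-\log_4 r$, so the limit over radii is a limit over
lengths. -/
theorem mem_levelSet_iff {μ : Measure SymbolicSpace} (hμ : ∀ x n, 0 < μ (cyl x n)) {α : ℝ}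
    {x : SymbolicSpace} : x ∈ levelSet μ α ↔
      Tendsto (fun n : ℕ => -Real.logb 4 (μ.real (cyl x n)) / n) atTop (𝓝 α) := by
  set g : ℝ → ℝ := fun r => Real.log (μ.real (Metric.ball x r)) / Real.log r with hg
  have h1 : x ∈ levelSet μ α ↔ Tendsto g (𝓝[>] 0) (𝓝 α) := by
    rw [← EReal.tendsto_coe]
    constructor
    · rintro ⟨-, h1, h2⟩
      exact tendsto_of_le_liminf_of_limsup_le h1 h2
    · exact fun h => ⟨mem_support hμ x, h.liminf_eq.ge, h.limsup_eq.le⟩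
  rw [h1]
  have hlog4 : Real.log 4 ≠ 0 := (Real.log_pos (by norm_num)).ne'
  constructor
  · intro h
    have hrad : Tendsto (fun n => radius (n + 1)) atTop (𝓝[>] 0) :=
      tendsto_nhdsWithin_iff.2 ⟨(tendsto_add_atTop_iff_nat 1).2 tendsto_radius,
        Eventually.of_forall fun n => radius_pos _⟩
    rw [← tendsto_add_atTop_iff_nat 1]
    have hq : Tendsto (fun n : ℕ => (n : ℝ) / ((n : ℝ) + 1)) atTop (𝓝 1) :=
      tendsto_natCast_div_add_atTop 1
    have := (h.comp hrad).mul hq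
    rw [mul_one] at this
    refine this.congr' ?_
    filter_upwards [eventually_gt_atTop 0] with n hn
    have hn' : (n : ℝ) ≠ 0 := by exact_mod_cast hn.ne'
    simp only [Function.comp, hg, ball_radius, Real.logb]
    rw [radius_succ, Real.log_rpow (by norm_num)]
    push_cast
    field_simp
  · intro h
    have hq : Tendsto (fun r : ℝ => (level r : ℝ) / (-Real.logb 4 r)) (𝓝[>] 0) (𝓝 1) := by
      have ht : Tendsto (fun r : ℝ => -Real.logb 4 r) (𝓝[>] 0) atTop := by
        refine tendsto_neg_atBot_atTop.comp ?_
        exact Real.tendsto_logb_nhdsGT_zero (by norm_num)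
      have h2 : Tendsto (fun y : ℝ => (⌊y⌋₊ : ℝ) / y + 1 / y) atTop (𝓝 (1 + 0)) :=
        tendsto_nat_floor_div_atTop.add (tendsto_const_nhds.div_atTop tendsto_id)
      rw [add_zero] at h2
      refine (h2.comp ht).congr fun r => ?_
      simp only [Function.comp, level]
      push_cast
      rw [add_div]
    have := (h.comp tendsto_level).mul hq
    rw [mul_one] at this
    refine this.congr' ?_
    filter_upwards [Ioo_mem_nhdsGT (zero_lt_one (α := ℝ))] with r hr
    have hl : (level r : ℝ) ≠ 0 := by
      have : level r ≠ 0 := by simp [level]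
      exact_mod_cast this
    have hlr : Real.log r ≠ 0 := (Real.log_neg hr.1 hr.2).ne
    simp only [Function.comp, hg, ball_eq_cyl_level hr.1 hr.2.le, Real.logb]
    field_simp

end SymbolicSpace

/-! ## Powers of four and product measures -/

/-- The power `4 ^ y` as an extended nonnegative number. -/
noncomputable def pow4 (y : ℝ) : ℝ≥0∞ := ENNReal.ofReal ((4 : ℝ) ^ y)

theorem pow4_ne_top (y : ℝ) : pow4 y ≠ ∞ := ENNReal.ofReal_ne_top

theorem pow4_pos (y : ℝ) : 0 < pow4 y := ENNReal.ofReal_pos.2 (by positivity)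

theorem pow4_add (y z : ℝ) : pow4 (y + z) = pow4 y * pow4 z := by
  unfold pow4
  rw [Real.rpow_add (by norm_num), ENNReal.ofReal_mul (by positivity)]

theorem pow4_le_pow4 {y z : ℝ} (h : y ≤ z) : pow4 y ≤ pow4 z :=
  ENNReal.ofReal_le_ofReal (Real.rpow_le_rpow_of_exponent_le (by norm_num) h)

theorem pow4_rpow (y t : ℝ) : pow4 y ^ t = pow4 (y * t) := by
  unfold pow4
  rw [ENNReal.ofReal_rpow_of_pos (by positivity), Real.rpow_mul (by norm_num)]

theorem pow4_logb {r : ℝ} (hr : 0 < r) : pow4 (Real.logb 4 r) = ENNReal.ofReal r := by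
  rw [pow4, Real.rpow_logb (by norm_num) (by norm_num) hr]

theorem exists_le_pow4 (M : ℕ) : ∃ c : ℝ, (M : ℝ≥0∞) ≤ pow4 c := by
  refine ⟨M, ?_⟩
  rw [pow4, ← ENNReal.ofReal_natCast]
  refine ENNReal.ofReal_le_ofReal ?_
  rw [Real.rpow_natCast]
  exact_mod_cast (Nat.lt_pow_self (by norm_num : 1 < 4)).le

theorem exists_pow4_le {ε : ℝ≥0∞} (hε : 0 < ε) : ∃ c : ℝ, pow4 c ≤ ε := by
  rcases eq_or_ne ε ∞ with rfl | h
  · exact ⟨0, le_top⟩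
  · refine ⟨Real.logb 4 ε.toReal, ?_⟩
    rw [pow4_logb (ENNReal.toReal_pos hε.ne' h), ENNReal.ofReal_toReal h]

theorem tsum_pow4_ne_top (c : ℝ) {d : ℝ} (hd : 0 < d) :
    ∑' n : ℕ, pow4 (c - n * d) ≠ ∞ := by
  have e : ∀ n : ℕ, pow4 (c - n * d) = pow4 c * pow4 (-d) ^ n := by
    intro n
    rw [← ENNReal.rpow_natCast, pow4_rpow, ← pow4_add]
    congr 1; ring
  simp only [e]
  rw [ENNReal.tsum_mul_left, ENNReal.tsum_geometric]
  refine ENNReal.mul_ne_top (pow4_ne_top _) (ENNReal.inv_ne_top.2 ?_)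
  have h1 : pow4 (-d) < 1 := by
    rw [pow4, ENNReal.ofReal_lt_one]
    exact Real.rpow_lt_one_of_one_lt_of_neg (by norm_num) (by linarith)
  exact (tsub_pos_of_lt h1).ne'

/-- The letter weights are positive and sum to `1` at every position. -/
structure IsWeights (P : ℕ → Fin 4 → ℝ) : Prop where
  pos : ∀ i l, 0 < P i l
  sum_eq : ∀ i, ∑ l, P i l = 1

/-- The law of a sequence of independent letters. -/
noncomputable def prodMeasure (P : ℕ → Fin 4 → ℝ) : Measure SymbolicSpace :=
  Measure.infinitePi fun i => letterMeasure (P i)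

/-- The base-four logarithm of the inverse mass of a word. -/
noncomputable def cost (P : ℕ → Fin 4 → ℝ) (n : ℕ) (u : Fin n → Fin 4) : ℝ :=
  ∑ i : Fin n, -Real.logb 4 (P i (u i))

open SymbolicSpace

theorem cost_word (P : ℕ → Fin 4 → ℝ) (x : SymbolicSpace) (n : ℕ) :
    cost P n (word x n) = ∑ i ∈ Finset.range n, -Real.logb 4 (P i (x i)) :=
  Fin.sum_univ_eq_sum_range (fun i => -Real.logb 4 (P i (x i))) n

theorem isProbabilityMeasure_letterMeasure {p : Fin 4 → ℝ} (hp : ∀ l, 0 < p l)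
    (hs : ∑ l, p l = 1) : IsProbabilityMeasure (letterMeasure p) := by
  constructor
  simp only [letterMeasure, Measure.coe_finsetSum, Finset.sum_apply, Measure.smul_apply,
    measure_univ, smul_eq_mul, mul_one]
  rw [← ENNReal.ofReal_sum_of_nonneg (fun k _ => (hp k).le), hs, ENNReal.ofReal_one]

theorem integral_letterMeasure {p : Fin 4 → ℝ} (hp : ∀ l, 0 < p l) (f : Fin 4 → ℝ) :
    ∫ l, f l ∂letterMeasure p = ∑ l, p l * f l := by
  rw [letterMeasure, integral_finsetSum_measure]
  · refine Finset.sum_congr rfl fun l _ => ?_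
    rw [integral_smul_measure, integral_dirac, ENNReal.toReal_ofReal (hp l).le, smul_eq_mul]
  · intro l _
    exact (integrable_dirac (by simp)).smul_measure ENNReal.ofReal_ne_top

variable {P : ℕ → Fin 4 → ℝ}

theorem IsWeights.isProbabilityMeasure (hP : IsWeights P) (i : ℕ) :
    IsProbabilityMeasure (letterMeasure (P i)) :=
  isProbabilityMeasure_letterMeasure (hP.pos i) (hP.sum_eq i)

theorem isProbabilityMeasure_prodMeasure (hP : IsWeights P) :
    IsProbabilityMeasure (prodMeasure P) := by
  have := hP.isProbabilityMeasure
  unfold prodMeasure; infer_instance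

theorem prodMeasure_cyl (hP : IsWeights P) (x : SymbolicSpace) (n : ℕ) :
    prodMeasure P (cyl x n) = pow4 (-cost P n (word x n)) := by
  have := hP.isProbabilityMeasure
  have hset : cyl x n = Set.pi (Finset.range n : Set ℕ) (fun i => ({x i} : Set (Fin 4))) := by
    ext y; simp [cyl, Set.mem_pi]
  rw [hset, prodMeasure, Measure.infinitePi_pi _ (fun i _ => MeasurableSet.singleton _), cost_word,
    pow4, ← Finset.sum_neg_distrib, Real.rpow_sum_of_pos (by norm_num),
    ENNReal.ofReal_prod_of_nonneg (fun i _ => by positivity)]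
  refine Finset.prod_congr rfl fun i _ => ?_
  rw [neg_neg, Real.rpow_logb (by norm_num) (by norm_num) (hP.pos _ _)]
  simp [letterMeasure, Set.indicator_apply]

/-- The sum over all words of length `n` of a product of functions of the letters. -/
theorem sum_words_prod (n : ℕ) (g : ℕ → Fin 4 → ℝ) :
    ∑ u : Fin n → Fin 4, ∏ i : Fin n, g i (u i) = ∏ i ∈ Finset.range n, ∑ l, g i l := by
  rw [← Fin.prod_univ_eq_prod_range (fun i => ∑ l, g i l) n, Finset.prod_univ_sum,
    Fintype.piFinset_univ]

/-! ## A law of large numbers -/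

open ProbabilityTheory in
-- By Hoeffding's lemma the letters are sub-Gaussian with parameter $M^2$; deviations of size
-- $n\varepsilon$ have summable probabilities $e^{-n\varepsilon^2/(2M^2)}$, and Borel–Cantelli
-- applies.
theorem ae_eventually_sum_lt (hP : IsWeights P) {f : ℕ → Fin 4 → ℝ} {M : ℝ} (hM : 0 < M)
    (hf : ∀ i l, |f i l| ≤ M) (h0 : ∀ i, ∑ l, P i l * f i l = 0) {ε : ℝ} (hε : 0 < ε) :
    ∀ᵐ x ∂prodMeasure P, ∀ᶠ n : ℕ in atTop, ∑ i ∈ Finset.range n, f i (x i) < n * ε := by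
  have := hP.isProbabilityMeasure
  have := isProbabilityMeasure_prodMeasure hP
  set X : ℕ → SymbolicSpace → ℝ := fun i x => f i (x i) with hX
  have hmeas : ∀ i, Measurable (f i) := fun i => measurable_of_finite _
  have hindep : iIndepFun X (prodMeasure P) := iIndepFun_infinitePi hmeas
  set c : ℝ≥0 := (‖M - -M‖₊ / 2) ^ 2 with hc
  have hcM : (c : ℝ) = M ^ 2 := by
    rw [hc]; push_cast
    rw [Real.norm_of_nonneg (by linarith)]
    ring
  have hsub : ∀ i, HasSubgaussianMGF (X i) c (prodMeasure P) := by
    intro i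
    refine hasSubgaussianMGF_of_mem_Icc_of_integral_eq_zero
      ((hmeas i).comp (measurable_pi_apply i)).aemeasurable
      (Eventually.of_forall fun x => abs_le.1 (hf i (x i))) ?_
    have hmp := measurePreserving_eval_infinitePi (fun i => letterMeasure (P i)) i
    have e : ∫ x, X i x ∂prodMeasure P = ∫ l, f i l ∂letterMeasure (P i) := by
      rw [← hmp.map_eq, integral_map (measurable_pi_apply i).aemeasurable
        (hmeas i).aestronglyMeasurable]
      rfl
    rw [e, integral_letterMeasure (hP.pos i), h0]
  set S : ℕ → Set SymbolicSpace := fun n => {x | n * ε ≤ ∑ i ∈ Finset.range n, X i x} with hS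
  have hbound : ∀ n, (prodMeasure P) (S n) ≤
      ENNReal.ofReal (Real.exp (n * (-(ε ^ 2 / (2 * M ^ 2))))) := by
    intro n
    have h1 := HasSubgaussianMGF.measure_sum_ge_le_of_iIndepFun hindep (c := fun _ => c)
      (s := Finset.range n) (fun i _ => hsub i) (ε := n * ε) (by positivity)
    rw [← ofReal_measureReal]
    refine ENNReal.ofReal_le_ofReal (h1.trans ?_)
    rw [Real.exp_le_exp]
    rw [Finset.sum_const, Finset.card_range, nsmul_eq_mul]
    push_cast
    rw [hcM]
    rcases Nat.eq_zero_or_pos n with rfl | hn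
    · simp
    · have : (0 : ℝ) < n := by exact_mod_cast hn
      apply le_of_eq
      field_simp
  have hsum : ∑' n, (prodMeasure P) (S n) ≠ ∞ := by
    refine ne_top_of_le_ne_top ?_ (ENNReal.tsum_le_tsum hbound)
    refine Summable.tsum_ofReal_ne_top (Real.summable_exp_nat_mul_iff.2 ?_)
    have : 0 < ε ^ 2 / (2 * M ^ 2) := by positivity
    linarith
  filter_upwards [ae_eventually_notMem hsum] with x hx
  filter_upwards [hx] with n hn
  simpa [hS, hX] using hn

theorem ae_tendsto_average (hP : IsWeights P) {f : ℕ → Fin 4 → ℝ} {M : ℝ} (hM : 0 < M)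
    (hf : ∀ i l, |f i l| ≤ M) (h0 : ∀ i, ∑ l, P i l * f i l = 0) :
    ∀ᵐ x ∂prodMeasure P,
      Tendsto (fun n : ℕ => (∑ i ∈ Finset.range n, f i (x i)) / n) atTop (𝓝 0) := by
  have h1 : ∀ᵐ x ∂prodMeasure P, ∀ k : ℕ, ∀ᶠ n : ℕ in atTop,
      ∑ i ∈ Finset.range n, f i (x i) < n * (1 / ((k : ℝ) + 1)) :=
    ae_all_iff.2 fun k => ae_eventually_sum_lt hP hM hf h0 (by positivity)
  have h2 : ∀ᵐ x ∂prodMeasure P, ∀ k : ℕ, ∀ᶠ n : ℕ in atTop,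
      ∑ i ∈ Finset.range n, -f i (x i) < n * (1 / ((k : ℝ) + 1)) :=
    ae_all_iff.2 fun k => ae_eventually_sum_lt (f := fun i l => -f i l) hP hM
      (fun i l => by rw [abs_neg]; exact hf i l)
      (fun i => by simp only [mul_neg, Finset.sum_neg_distrib, h0, neg_zero]) (by positivity)
  filter_upwards [h1, h2] with x hx1 hx2
  rw [Metric.tendsto_atTop']
  intro ε hε
  obtain ⟨k, hk⟩ := exists_nat_one_div_lt hε
  obtain ⟨N, hN⟩ := eventually_atTop.1 ((hx1 k).and (hx2 k))
  refine ⟨N, fun n hn => ?_⟩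
  have hn0 : (0 : ℝ) < n := by exact_mod_cast (Nat.zero_le N).trans_lt hn
  obtain ⟨k1, k2⟩ := hN n hn.le
  rw [Finset.sum_neg_distrib] at k2
  rw [dist_zero_right, Real.norm_eq_abs, abs_div, abs_of_pos hn0, div_lt_iff₀ hn0, mul_comm]
  refine (abs_lt.2 ⟨by linarith, k1⟩).trans ?_
  exact mul_lt_mul_of_pos_left hk hn0

/-! ## Alternating weights and Gibbs weights -/

section Mix

open scoped Classical in
/-- The sequence equal to `y` on `O` and to `z` off `O`. -/
noncomputable def mix {γ : Type*} (O : ℕ → Prop) (y z : γ) (i : ℕ) : γ := if O i then y else z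

variable {O : ℕ → Prop}

theorem mix_of {γ : Type*} {y z : γ} {R : γ → Prop} (i : ℕ) (hy : R y) (hz : R z) :
    R (mix O y z i) := by
  unfold mix; split_ifs <;> assumption

/-- The partial sums of a sequence with two values. -/
noncomputable def mixSum (O : ℕ → Prop) (y z : ℝ) (n : ℕ) : ℝ := ∑ i ∈ Finset.range n, mix O y z i

/-- The upper frequencies of `O` and of its complement are both `1`. -/
def IsOscillating (O : ℕ → Prop) : Prop := ∀ η : ℝ, 0 < η →
  (∃ᶠ n : ℕ in atTop, mixSum O 0 1 n ≤ n * η) ∧ (∃ᶠ n : ℕ in atTop, mixSum O 1 0 n ≤ n * η)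

theorem le_mixSum {y z : ℝ} (h : z ≤ y) (n : ℕ) : n * z ≤ mixSum O y z n := by
  have := Finset.card_nsmul_le_sum (Finset.range n) (mix O y z) z
    fun i _ => mix_of (R := fun c => z ≤ c) i h le_rfl
  simpa [mixSum] using this

theorem mixSum_le {y z : ℝ} (h : z ≤ y) (n : ℕ) : mixSum O y z n ≤ n * y := by
  have := Finset.sum_le_card_nsmul (Finset.range n) (mix O y z) y
    fun i _ => mix_of (R := fun c => c ≤ y) i le_rfl h
  simpa [mixSum] using this

theorem mixSum_eq (y z : ℝ) (n : ℕ) : mixSum O y z n = n * y - mixSum O 0 1 n * (y - z) := by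
  have e : ∀ i, mix O y z i = y - mix O 0 1 i * (y - z) := by
    intro i; unfold mix; split_ifs <;> ring
  simp [mixSum, e, Finset.sum_mul]

theorem mixSum_eq' (y z : ℝ) (n : ℕ) : mixSum O y z n = n * z + mixSum O 1 0 n * (y - z) := by
  have e : ∀ i, mix O y z i = z + mix O 1 0 i * (y - z) := by
    intro i; unfold mix; split_ifs <;> ring
  simp [mixSum, e, Finset.sum_mul, Finset.sum_add_distrib]

theorem IsOscillating.frequently_le_mixSum (hO : IsOscillating O) {y z : ℝ} (h : z ≤ y) {ε : ℝ}
    (hε : 0 < ε) : ∃ᶠ n : ℕ in atTop, n * (y - ε) ≤ mixSum O y z n := by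
  -- The `+ 1` keeps the denominator positive when $y=z$.
  refine (hO (ε / (y - z + 1)) (div_pos hε (by linarith))).1.mono fun n hn => ?_
  rw [mixSum_eq]
  have h1 : ε / (y - z + 1) * (y - z) ≤ ε := by
    rw [div_mul_eq_mul_div, div_le_iff₀ (by linarith)]
    nlinarith
  have h2 := mul_le_mul_of_nonneg_right hn (sub_nonneg.2 h)
  have h3 := mul_le_mul_of_nonneg_left h1 (Nat.cast_nonneg (α := ℝ) n)
  linarith

theorem IsOscillating.frequently_mixSum_le (hO : IsOscillating O) {y z : ℝ} (h : z ≤ y) {ε : ℝ}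
    (hε : 0 < ε) : ∃ᶠ n : ℕ in atTop, mixSum O y z n ≤ n * (z + ε) := by
  refine (hO (ε / (y - z + 1)) (div_pos hε (by linarith))).2.mono fun n hn => ?_
  rw [mixSum_eq']
  have h1 : ε / (y - z + 1) * (y - z) ≤ ε := by
    rw [div_mul_eq_mul_div, div_le_iff₀ (by linarith)]
    nlinarith
  have h2 := mul_le_mul_of_nonneg_right hn (sub_nonneg.2 h)
  have h3 := mul_le_mul_of_nonneg_left h1 (Nat.cast_nonneg (α := ℝ) n)
  linarith

end Mix

/-! ### Gibbs weights and the Legendre transform -/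

section Gibbs

/-- The function `q ↦ log₄ (p₁ ^ q + p₂ ^ q + p₃ ^ q + p₄ ^ q)`. -/
noncomputable def tau (p : Fin 4 → ℝ) (q : ℝ) : ℝ := Real.logb 4 (∑ l, p l ^ q)

/-- The Gibbs weights proportional to `p ^ q`. -/
noncomputable def gibbs (p : Fin 4 → ℝ) (q : ℝ) (l : Fin 4) : ℝ := p l ^ q * (4 : ℝ) ^ (-tau p q)

variable {p : Fin 4 → ℝ}

theorem sum_rpow_pos (hp : ∀ l, 0 < p l) (q : ℝ) : 0 < ∑ l, p l ^ q :=
  Finset.sum_pos (fun l _ => Real.rpow_pos_of_pos (hp l) q) Finset.univ_nonempty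

theorem rpow_tau (hp : ∀ l, 0 < p l) (q : ℝ) : (4 : ℝ) ^ tau p q = ∑ l, p l ^ q :=
  Real.rpow_logb (by norm_num) (by norm_num) (sum_rpow_pos hp q)

theorem gibbs_pos (hp : ∀ l, 0 < p l) (q : ℝ) (l : Fin 4) : 0 < gibbs p q l :=
  mul_pos (Real.rpow_pos_of_pos (hp l) q) (by positivity)

theorem sum_gibbs (hp : ∀ l, 0 < p l) (q : ℝ) : ∑ l, gibbs p q l = 1 := by
  unfold gibbs
  rw [← Finset.sum_mul, ← rpow_tau hp, ← Real.rpow_add (by norm_num), add_neg_cancel,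
    Real.rpow_zero]

theorem gibbs_le_one (hp : ∀ l, 0 < p l) (q : ℝ) (l : Fin 4) : gibbs p q l ≤ 1 := by
  rw [← sum_gibbs hp q]
  exact Finset.single_le_sum (fun i _ => (gibbs_pos hp q i).le) (Finset.mem_univ l)

theorem neg_logb_gibbs (hp : ∀ l, 0 < p l) (q : ℝ) (l : Fin 4) :
    -Real.logb 4 (gibbs p q l) = q * -Real.logb 4 (p l) + tau p q := by
  rw [gibbs, Real.logb_mul (Real.rpow_pos_of_pos (hp l) q).ne' (by positivity),
    Real.logb_rpow_eq_mul_logb_of_pos (hp l), Real.logb_rpow (by norm_num) (by norm_num)]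
  ring

theorem rpow_le_sum_rpow (hp : ∀ l, 0 < p l) (q : ℝ) (l : Fin 4) :
    q * Real.logb 4 (p l) ≤ tau p q := by
  rw [← Real.logb_rpow_eq_mul_logb_of_pos (hp l)]
  exact Real.logb_le_logb_of_le (by norm_num) (Real.rpow_pos_of_pos (hp l) q)
    (Finset.single_le_sum (f := fun l => p l ^ q)
      (fun i _ => (Real.rpow_pos_of_pos (hp i) q).le) (Finset.mem_univ l))

theorem hasDerivAt_tau (hp : ∀ l, 0 < p l) (q : ℝ) :
    HasDerivAt (tau p) (∑ l, gibbs p q l * Real.logb 4 (p l)) q := by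
  have h := (hasDerivAt_theta hp q).div_const (Real.log 4)
  refine HasDerivAt.congr_deriv (f := fun q => theta p q / Real.log 4) h ?_
  rw [div_div, Finset.sum_div]
  refine Finset.sum_congr rfl fun l _ => ?_
  rw [gibbs, Real.rpow_neg (by norm_num), rpow_tau hp, Real.logb]
  field_simp

/-- The infimum defining the Legendre transform of `tau p` is attained at a Gibbs state. -/
theorem exists_legendre_min (hp : ∀ l, 0 < p l) {α : ℝ} {l m : Fin 4}
    (h1 : -Real.logb 4 (p l) < α) (h2 : α < -Real.logb 4 (p m)) :
    ∃ q, (∀ y, α * q + tau p q ≤ α * y + tau p y) ∧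
      ∑ l, gibbs p q l * -Real.logb 4 (p l) = α := by
  have hd : ∀ q, HasDerivAt (fun q => α * q + tau p q)
      (α * 1 + ∑ l, gibbs p q l * Real.logb 4 (p l)) q := fun q =>
    ((hasDerivAt_id q).const_mul α).add (hasDerivAt_tau hp q)
  have hc : Continuous fun q => α * q + tau p q :=
    continuous_iff_continuousAt.2 fun q => (hd q).continuousAt
  -- Since $\tau(q)\ge q\log_4p_i$ for each letter, the function dominates a line of negative slope
  -- (letter `m`) and one of positive slope (letter `l`).
  have hlim : Tendsto (fun q => α * q + tau p q) (cocompact ℝ) atTop := by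
    rw [cocompact_eq_atBot_atTop]
    refine tendsto_sup.2 ⟨?_, ?_⟩
    · refine tendsto_atTop_mono (fun q => ?_)
        (tendsto_id.const_mul_atBot_of_neg (show α + Real.logb 4 (p m) < 0 by linarith))
      have := rpow_le_sum_rpow hp q m
      simp only [id]; linarith
    · refine tendsto_atTop_mono (fun q => ?_)
        (tendsto_id.const_mul_atTop (show 0 < α + Real.logb 4 (p l) by linarith))
      have := rpow_le_sum_rpow hp q l
      simp only [id]; linarith
  obtain ⟨q, hq⟩ := hc.exists_forall_le hlim
  refine ⟨q, hq, ?_⟩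
  -- The critical point equation $\alpha+\tau'(q)=0$ says that the Gibbs weights have mean exponent
  -- $\alpha$.
  have := IsLocalMin.hasDerivAt_eq_zero (Eventually.of_forall hq) (hd q)
  simp only [mul_neg, Finset.sum_neg_distrib]
  linarith

/-- The Legendre value is the base-four entropy of the Gibbs weights, by averaging $-\log_4$ of each
weight. -/
theorem sum_gibbs_mul_neg_logb_gibbs (hp : ∀ l, 0 < p l) {q α : ℝ}
    (h : ∑ l, gibbs p q l * -Real.logb 4 (p l) = α) :
    ∑ l, gibbs p q l * -Real.logb 4 (gibbs p q l) = α * q + tau p q := by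
  have e : ∀ l, gibbs p q l * -Real.logb 4 (gibbs p q l) =
      q * (gibbs p q l * -Real.logb 4 (p l)) + gibbs p q l * tau p q := fun l => by
    rw [neg_logb_gibbs hp]; ring
  simp only [e]
  rw [Finset.sum_add_distrib, ← Finset.mul_sum, ← Finset.sum_mul, h, sum_gibbs hp]
  ring

theorem legendre_value_nonneg (hp : ∀ l, 0 < p l) {q α : ℝ}
    (h : ∑ l, gibbs p q l * -Real.logb 4 (p l) = α) : 0 ≤ α * q + tau p q := by
  rw [← sum_gibbs_mul_neg_logb_gibbs hp h]
  refine Finset.sum_nonneg fun l _ => mul_nonneg (gibbs_pos hp q l).le ?_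
  have := Real.logb_nonpos (b := 4) (by norm_num) (gibbs_pos hp q l).le (gibbs_le_one hp q l)
  linarith

end Gibbs

/-! ### Product measures with two alternating weight vectors -/

section MixedMeasure

variable {O : ℕ → Prop} {a b : Fin 4 → ℝ}

theorem isWeights_mix (ha : ∀ l, 0 < a l) (hb : ∀ l, 0 < b l) (hsa : ∑ l, a l = 1)
    (hsb : ∑ l, b l = 1) : IsWeights (mix O a b) :=
  ⟨fun i l => mix_of (R := fun p : Fin 4 → ℝ => 0 < p l) i (ha l) (hb l),
    fun i => mix_of (R := fun p : Fin 4 → ℝ => ∑ l, p l = 1) i hsa hsb⟩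

theorem isWeights_mix_gibbs (ha : ∀ l, 0 < a l) (hb : ∀ l, 0 < b l) (q q' : ℝ) :
    IsWeights (mix O (gibbs a q) (gibbs b q')) :=
  isWeights_mix (gibbs_pos ha q) (gibbs_pos hb q') (sum_gibbs ha q) (sum_gibbs hb q')

/-- In terms of masses, $\nu_q(C)=\mu(C)^q4^{-s_n}$: this makes the Gibbs measure comparable with
Olsen's weights. -/
theorem cost_mix_gibbs (ha : ∀ l, 0 < a l) (hb : ∀ l, 0 < b l) (q : ℝ) (n : ℕ)
    (u : Fin n → Fin 4) : cost (mix O (gibbs a q) (gibbs b q)) n u =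
      q * cost (mix O a b) n u + mixSum O (tau a q) (tau b q) n := by
  rw [cost, cost, mixSum, ← Fin.sum_univ_eq_sum_range, Finset.mul_sum, ← Finset.sum_add_distrib]
  refine Finset.sum_congr rfl fun i _ => ?_
  unfold mix
  split_ifs
  · exact neg_logb_gibbs ha q _
  · exact neg_logb_gibbs hb q _

/-- The partition function: the `q`-th moment of the cylinder masses. -/
theorem sum_pow4_cost (ha : ∀ l, 0 < a l) (hb : ∀ l, 0 < b l) (q c : ℝ) (n : ℕ) :
    ∑ u, pow4 (c - q * cost (mix O a b) n u) = pow4 (c + mixSum O (tau a q) (tau b q) n) := by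
  have h1 : ∑ u : Fin n → Fin 4, pow4 (-cost (mix O (gibbs a q) (gibbs b q)) n u) = 1 := by
    have hW : IsWeights (mix O (gibbs a q) (gibbs b q)) := isWeights_mix_gibbs ha hb q q
    have e : ∀ u : Fin n → Fin 4, pow4 (-cost (mix O (gibbs a q) (gibbs b q)) n u) =
        ENNReal.ofReal (∏ i : Fin n, mix O (gibbs a q) (gibbs b q) i (u i)) := by
      intro u
      rw [pow4, cost, ← Finset.sum_neg_distrib, Real.rpow_sum_of_pos (by norm_num)]
      congr 1
      refine Finset.prod_congr rfl fun i _ => ?_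
      rw [neg_neg, Real.rpow_logb (by norm_num) (by norm_num) (hW.pos _ _)]
    simp only [e]
    rw [← ENNReal.ofReal_sum_of_nonneg fun u _ => Finset.prod_nonneg fun i _ => (hW.pos _ _).le,
      sum_words_prod]
    simp only [hW.sum_eq, Finset.prod_const_one, ENNReal.ofReal_one]
  have e : ∀ u : Fin n → Fin 4, pow4 (c - q * cost (mix O a b) n u) =
      pow4 (c + mixSum O (tau a q) (tau b q) n) *
        pow4 (-cost (mix O (gibbs a q) (gibbs b q)) n u) := by
    intro u
    rw [← pow4_add, cost_mix_gibbs ha hb]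
    congr 1; ring
  simp only [e]
  rw [← Finset.mul_sum, h1, mul_one]

theorem ae_tendsto_average_mix {p p' f f' : Fin 4 → ℝ} (hp : ∀ l, 0 < p l) (hp' : ∀ l, 0 < p' l)
    (hs : ∑ l, p l = 1) (hs' : ∑ l, p' l = 1) (h0 : ∑ l, p l * f l = 0)
    (h0' : ∑ l, p' l * f' l = 0) :
    ∀ᵐ x ∂prodMeasure (mix O p p'),
      Tendsto (fun n : ℕ => (∑ i ∈ Finset.range n, mix O f f' i (x i)) / n) atTop (𝓝 0) := by
  have hM : ∀ g : Fin 4 → ℝ, ∀ l, |g l| ≤ ∑ l, |g l| := fun g l =>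
    Finset.single_le_sum (f := fun l => |g l|) (fun i _ => abs_nonneg _) (Finset.mem_univ l)
  have hn : ∀ g : Fin 4 → ℝ, 0 ≤ ∑ l, |g l| := fun g => Finset.sum_nonneg fun i _ => abs_nonneg _
  refine ae_tendsto_average (isWeights_mix hp hp' hs hs')
    (M := ∑ l, |f l| + ∑ l, |f' l| + 1) (by linarith [hn f, hn f']) (fun i l => ?_) fun i => ?_
  · exact mix_of (R := fun g : Fin 4 → ℝ => |g l| ≤ _) i
      (by linarith [hM f l, hn f']) (by linarith [hM f' l, hn f])
  · unfold mix; split_ifs <;> assumption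

end MixedMeasure

/-! ## Olsen's functions and the level sets for alternating weights -/

theorem iSup_eq_of_threshold {F : ℝ → ℝ≥0∞} {v : ℝ} (h0 : ∀ s, v < s → F s = 0)
    (h1 : ∀ s, s < v → F s = ∞) : ⨆ (s : ℝ) (_ : F s = ∞), (s : EReal) = v := by
  refine le_antisymm (iSup₂_le fun s hs => ?_) (le_of_forall_lt fun c hc => ?_)
  · rw [EReal.coe_le_coe_iff]
    by_contra hlt
    rw [h0 s (not_le.1 hlt)] at hs
    exact ENNReal.zero_ne_top hs
  · obtain ⟨s, hcs, hsv⟩ := EReal.lt_iff_exists_real_btwn.1 hc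
    exact hcs.trans_le (le_iSup₂ (f := fun (s : ℝ) (_ : F s = ∞) => (s : EReal)) s
      (h1 s (EReal.coe_lt_coe_iff.1 hsv)))

theorem packing_eq_zero {X : Type*} [MetricSpace X] {w : X × ℝ → ℝ≥0∞} {E : Set X} (U : ℕ → Set X)
    (hE : E ⊆ ⋃ i, U i) (h : ∀ i, prePacking w (U i) = 0) : packing w E = 0 := by
  refine le_antisymm ((iInf₂_le U hE).trans ?_) zero_le
  simp [h]

theorem lt_of_ofReal_lt_coe {v : ℝ} {t : ℝ≥0} (h : ENNReal.ofReal v < t) : v < t := by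
  by_contra hc
  rw [← ENNReal.ofReal_coe_nnreal] at h
  exact absurd (ENNReal.ofReal_le_ofReal (not_lt.1 hc)) (not_le.2 h)

theorem logb_radius (n : ℕ) : Real.logb 4 (radius n) = 1 - n := by
  rw [radius, Real.logb_mul (by norm_num) (by positivity), Real.logb_rpow (by norm_num)
    (by norm_num), Real.logb_self_eq_one (by norm_num)]
  ring

theorem logb_bounds {r : ℝ} {n : ℕ} (h1 : (4 : ℝ) ^ (-(n : ℝ)) < r) (h2 : r ≤ radius n) :
    -(n : ℝ) ≤ Real.logb 4 r ∧ Real.logb 4 r ≤ 1 - n := by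
  have h4 : (0 : ℝ) < 4 ^ (-(n : ℝ)) := by positivity
  constructor
  · have := Real.logb_le_logb_of_le (b := 4) (by norm_num) h4 h1.le
    rwa [Real.logb_rpow (by norm_num) (by norm_num)] at this
  · have := Real.logb_le_logb_of_le (b := 4) (by norm_num) (h4.trans h1) h2
    rwa [logb_radius] at this

/-- On a ball of level $n$, $r$ is $4^{-n}$ up to a factor in $[1,4]$, which costs at most $4^{|s|}$
for either sign of $s$. Cylinders have positive mass, so no term is omitted. -/
theorem olsenWeight_bounds {P : ℕ → Fin 4 → ℝ} (hP : IsWeights P) (q s : ℝ) (x : SymbolicSpace)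
    {r : ℝ} {n : ℕ} (h1 : (4 : ℝ) ^ (-(n : ℝ)) < r) (h2 : r ≤ radius n) :
    pow4 (-|s| - n * s - q * cost P n (word x n)) ≤ olsenWeight (prodMeasure P) q s (x, r) ∧
    olsenWeight (prodMeasure P) q s (x, r) ≤ pow4 (|s| - n * s - q * cost P n (word x n)) := by
  have hr : 0 < r := lt_trans (by positivity) h1
  have e : olsenWeight (prodMeasure P) q s (x, r) =
      pow4 (Real.logb 4 r * s + -cost P n (word x n) * q) := by
    rw [olsenWeight, ball_eq_cyl h1 h2, prodMeasure_cyl hP, if_neg fun h => (pow4_pos _).ne' h.1,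
      ← pow4_logb hr, pow4_rpow, pow4_rpow, pow4_add]
  obtain ⟨k1, k2⟩ := logb_bounds h1 h2
  have k : |(Real.logb 4 r + n) * s| ≤ |s| := by
    rw [abs_mul]
    have : |Real.logb 4 r + n| ≤ 1 := abs_le.2 ⟨by linarith, by linarith⟩
    exact mul_le_of_le_one_left (abs_nonneg s) this
  obtain ⟨k3, k4⟩ := abs_le.1 k
  rw [e]
  exact ⟨pow4_le_pow4 (by linarith), pow4_le_pow4 (by linarith)⟩

theorem tendsto_natCast_mul_atTop {d : ℝ} (hd : 0 < d) :
    Tendsto (fun n : ℕ => (n : ℝ) * d) atTop atTop :=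
  tendsto_natCast_atTop_atTop.atTop_mul_const hd

section Alternating

variable {O : ℕ → Prop} {a b : Fin 4 → ℝ}

/-- Above $\tau_a(q)$ the sums over words are at most geometric, since $s_n\le n\tau_a(q)$. Below
it, $\nu_q$ is a test measure along the lengths where $s_n$ is nearly $n\tau_a(q)$. -/
theorem olsenB_prodMeasure (hO : IsOscillating O) (ha : ∀ l, 0 < a l) (hb : ∀ l, 0 < b l)
    (hsa : ∑ l, a l = 1) (hsb : ∑ l, b l = 1) {q : ℝ} (hq : tau b q ≤ tau a q) :
    olsenB (prodMeasure (mix O a b)) q = tau a q := by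
  have hW : IsWeights (mix O a b) := isWeights_mix ha hb hsa hsb
  have hpos : ∀ x n, 0 < prodMeasure (mix O a b) (cyl x n) := fun x n => by
    rw [prodMeasure_cyl hW]; exact pow4_pos _
  have hsupp : (prodMeasure (mix O a b)).support = Set.univ :=
    Set.eq_univ_of_forall (SymbolicSpace.mem_support hpos)
  refine iSup_eq_of_threshold (F := fun s => packing (olsenWeight (prodMeasure (mix O a b)) q s)
    (prodMeasure (mix O a b)).support) (fun s hs => ?_) fun s hs => ?_
  · refine packing_eq_zero (fun _ => Set.univ) (fun x _ => Set.mem_iUnion.2 ⟨0, trivial⟩) fun _ => ?_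
    refine prePacking_eq_zero (N := 0) (fun n u => pow4 (|s| - n * s - q * cost (mix O a b) n u))
      (fun n => pow4 (|s| - n * (s - tau a q))) (tsum_pow4_ne_top _ (sub_pos.2 hs)) ?_ ?_
    · intro n _
      rw [sum_pow4_cost ha hb]
      have := mixSum_le (O := O) hq n
      exact pow4_le_pow4 (by linarith)
    · intro x _ r h0 h1 _
      exact (olsenWeight_bounds hW q s x (level_spec h0 h1).1 (level_spec h0 h1).2).2
  · have hWg : IsWeights (mix O (gibbs a q) (gibbs b q)) := isWeights_mix_gibbs ha hb q q
    have := isProbabilityMeasure_prodMeasure hWg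
    refine packing_eq_top (prodMeasure (mix O (gibbs a q) (gibbs b q))) (fun _ => Set.univ)
      (by rw [hsupp]; simp) fun _ M => ?_
    obtain ⟨c, hc⟩ := exists_le_pow4 M
    set ε := (tau a q - s) / 2 with hε
    have hε0 : 0 < ε := by rw [hε]; linarith
    have hev := (tendsto_natCast_mul_atTop hε0).eventually_ge_atTop (c + |s|)
    refine ((hO.frequently_le_mixSum hq hε0).and_eventually hev).mono fun n hn x _ => ?_
    refine le_trans ?_ (olsenWeight_bounds hW q s x (rpow_neg_lt_radius n) le_rfl).1
    rw [prodMeasure_cyl hWg, cost_mix_gibbs ha hb]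
    refine (mul_le_mul_left hc _).trans ?_
    rw [← pow4_add]
    have e : (n : ℝ) * (tau a q - ε) = n * s + n * ε := by rw [hε]; ring
    exact pow4_le_pow4 (by linarith [hn.1, hn.2])

/-- The roles are reversed: coverings use the lengths where $s_n$ is nearly $n\tau_b(q)$, while
$s_n\ge n\tau_b(q)$ at every length controls all coverings. -/
theorem olsenb_prodMeasure (hO : IsOscillating O) (ha : ∀ l, 0 < a l) (hb : ∀ l, 0 < b l)
    (hsa : ∑ l, a l = 1) (hsb : ∑ l, b l = 1) {q : ℝ} (hq : tau b q ≤ tau a q) :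
    olsenb (prodMeasure (mix O a b)) q = tau b q := by
  have hW : IsWeights (mix O a b) := isWeights_mix ha hb hsa hsb
  have hpos : ∀ x n, 0 < prodMeasure (mix O a b) (cyl x n) := fun x n => by
    rw [prodMeasure_cyl hW]; exact pow4_pos _
  have hsupp : (prodMeasure (mix O a b)).support = Set.univ :=
    Set.eq_univ_of_forall (SymbolicSpace.mem_support hpos)
  refine iSup_eq_of_threshold (F := fun s => centeredHausdorff
    (olsenWeight (prodMeasure (mix O a b)) q s) (prodMeasure (mix O a b)).support)
    (fun s hs => ?_) fun s hs => ?_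
  · refine centeredHausdorff_eq_zero (fun n u => pow4 (|s| - n * s - q * cost (mix O a b) n u))
      (fun ε hε => ?_) fun x _ n =>
        (olsenWeight_bounds hW q s x (rpow_neg_lt_radius n) le_rfl).2
    obtain ⟨c, hc⟩ := exists_pow4_le hε
    set d := (s - tau b q) / 2 with hd
    have hd0 : 0 < d := by rw [hd]; linarith
    have hev := (tendsto_natCast_mul_atTop hd0).eventually_ge_atTop (|s| - c)
    refine ((hO.frequently_mixSum_le hq hd0).and_eventually hev).mono fun n hn => ?_
    rw [sum_pow4_cost ha hb]
    refine (pow4_le_pow4 ?_).trans hc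
    have e : (n : ℝ) * (tau b q + d) = n * s - n * d := by rw [hd]; ring
    linarith [hn.1, hn.2]
  · have hWg : IsWeights (mix O (gibbs a q) (gibbs b q)) := isWeights_mix_gibbs ha hb q q
    have := isProbabilityMeasure_prodMeasure hWg
    refine centeredHausdorff_eq_top (prodMeasure (mix O (gibbs a q) (gibbs b q)))
      (by rw [hsupp]; simp) fun M => ?_
    obtain ⟨c, hc⟩ := exists_le_pow4 M
    obtain ⟨N, hN⟩ := eventually_atTop.1
      ((tendsto_natCast_mul_atTop (sub_pos.2 hs)).eventually_ge_atTop (c + |s|))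
    refine ⟨(4 : ℝ) ^ (-(N : ℝ)), by positivity, fun x r h0 hr => ?_⟩
    have h1 : r ≤ 1 := hr.le.trans
      (Real.rpow_le_one_of_one_le_of_nonpos (by norm_num) (by simp))
    have hn := hN _ (lt_level h0 hr.le).le
    refine le_trans ?_ (olsenWeight_bounds hW q s x (level_spec h0 h1).1 (level_spec h0 h1).2).1
    rw [ball_eq_cyl_level h0 h1, prodMeasure_cyl hWg, cost_mix_gibbs ha hb]
    refine (mul_le_mul_left hc _).trans ?_
    rw [← pow4_add]
    have := le_mixSum (O := O) hq (level r)
    exact pow4_le_pow4 (by linarith)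

theorem logb_prodMeasure_real {P : ℕ → Fin 4 → ℝ} (hP : IsWeights P) (x : SymbolicSpace) (n : ℕ) :
    -Real.logb 4 ((prodMeasure P).real (cyl x n)) = cost P n (word x n) := by
  rw [measureReal_def, prodMeasure_cyl hP, pow4, ENNReal.toReal_ofReal (by positivity),
    Real.logb_rpow (by norm_num) (by norm_num), neg_neg]

theorem mem_levelSet_prodMeasure {P : ℕ → Fin 4 → ℝ} (hP : IsWeights P) {α : ℝ}
    {x : SymbolicSpace} : x ∈ levelSet (prodMeasure P) α ↔
      Tendsto (fun n : ℕ => cost P n (word x n) / n) atTop (𝓝 α) := by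
  rw [mem_levelSet_iff fun x n => by rw [prodMeasure_cyl hP]; exact pow4_pos _]
  simp only [logb_prodMeasure_real hP]

/-- Makes the convergence uniform on countably many pieces; multiplying the limit by $q$ treats both
signs at once. -/
theorem levelSet_subset_iUnion {P : ℕ → Fin 4 → ℝ} (hP : IsWeights P) (α q : ℝ) {ε : ℝ}
    (hε : 0 < ε) : levelSet (prodMeasure P) α ⊆
      ⋃ N : ℕ, {x | ∀ n, N ≤ n → q * cost P n (word x n) ≤ n * (α * q + ε)} := by
  intro x hx
  have h1 := ((mem_levelSet_prodMeasure hP).1 hx).const_mul q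
  have h2 := h1.eventually_lt_const (show q * α < α * q + ε by linarith)
  obtain ⟨N, hN⟩ := eventually_atTop.1 (h2.and (eventually_gt_atTop 0))
  refine Set.mem_iUnion.2 ⟨N, fun n hn => ?_⟩
  obtain ⟨k1, k2⟩ := hN n hn
  have k3 : (0 : ℝ) < n := by exact_mod_cast k2
  rw [← mul_div_assoc, div_lt_iff₀ k3] at k1
  linarith

theorem dimH_levelSet_le (hO : IsOscillating O) (ha : ∀ l, 0 < a l) (hb : ∀ l, 0 < b l)
    (hsa : ∑ l, a l = 1) (hsb : ∑ l, b l = 1) {α q : ℝ} (hq : tau b q ≤ tau a q) :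
    dimH (levelSet (prodMeasure (mix O a b)) α) ≤ ENNReal.ofReal (α * q + tau b q) := by
  have hW : IsWeights (mix O a b) := isWeights_mix ha hb hsa hsb
  refine le_of_forall_gt_imp_ge_of_dense fun t' ht' => ?_
  obtain ⟨t, htt, ht⟩ := ENNReal.lt_iff_exists_nnreal_btwn.1 ht'
  refine le_trans ?_ ht.le
  have htv := lt_of_ofReal_lt_coe htt
  refine dimH_le_of_hausdorffMeasure_ne_top ?_
  -- One third pays for the level set, one for the oscillation of $s_n$, and one drives the sums to
  -- $0$. For packings two parts suffice, as $s_n\le n\tau_a(q)$ holds without error.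
  set ε := (t - (α * q + tau b q)) / 3 with hε
  have hε0 : 0 < ε := by rw [hε]; linarith
  have h0 : Measure.hausdorffMeasure (t : ℝ) (levelSet (prodMeasure (mix O a b)) α) = 0 := by
    refine measure_mono_null (levelSet_subset_iUnion hW α q hε0) (measure_iUnion_null fun N => ?_)
    refine hausdorffMeasure_eq_zero t.coe_nonneg (N := N)
      (fun n u => pow4 (-(n * (t - (α * q + ε))) - q * cost (mix O a b) n u)) (fun η hη => ?_) ?_
    · obtain ⟨c, hc⟩ := exists_pow4_le hη
      have hev := (tendsto_natCast_mul_atTop hε0).eventually_ge_atTop (-c)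
      refine ((hO.frequently_mixSum_le hq hε0).and_eventually hev).mono fun n hn => ?_
      rw [sum_pow4_cost ha hb]
      refine (pow4_le_pow4 ?_).trans hc
      have e : (n : ℝ) * (t - (α * q + ε)) = n * (tau b q + ε) + n * ε := by rw [hε]; ring
      linarith [hn.1, hn.2]
    · intro x hx n hn
      refine pow4_le_pow4 ?_
      have := hx n hn
      linarith
  rw [h0]
  exact ENNReal.zero_ne_top

theorem packingDim_levelSet_le (ha : ∀ l, 0 < a l) (hb : ∀ l, 0 < b l)
    (hsa : ∑ l, a l = 1) (hsb : ∑ l, b l = 1) {α q : ℝ} (hq : tau b q ≤ tau a q) :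
    packingDim (levelSet (prodMeasure (mix O a b)) α) ≤ ENNReal.ofReal (α * q + tau a q) := by
  have hW : IsWeights (mix O a b) := isWeights_mix ha hb hsa hsb
  refine iSup₂_le fun t ht => ?_
  by_contra hc
  replace hc := lt_of_ofReal_lt_coe (not_le.1 hc)
  set ε := (t - (α * q + tau a q)) / 2 with hε
  have hε0 : 0 < ε := by rw [hε]; linarith
  refine ENNReal.zero_ne_top (Eq.trans (Eq.symm ?_) ht)
  refine packing_eq_zero _ (levelSet_subset_iUnion hW α q hε0) fun N => ?_
  refine prePacking_eq_zero (N := N)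
    (fun n u => pow4 (t - n * (t - (α * q + ε)) - q * cost (mix O a b) n u))
    (fun n => pow4 (t - n * ε)) (tsum_pow4_ne_top _ hε0) (fun n _ => ?_) ?_
  · rw [sum_pow4_cost ha hb]
    refine pow4_le_pow4 ?_
    have := mixSum_le (O := O) hq n
    have e : (n : ℝ) * (t - (α * q + ε)) = n * tau a q + n * ε := by rw [hε]; ring
    linarith
  · intro x hx r h0 h1 hn
    have k := hx _ hn
    have k2 := (logb_bounds (level_spec h0 h1).1 (level_spec h0 h1).2).2
    have k3 := mul_le_mul_of_nonneg_right k2 t.coe_nonneg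
    rw [← pow4_logb h0, pow4_rpow]
    exact pow4_le_pow4 (by linarith)

/-- The mixed Gibbs measure lives on the level set, and almost surely $-\log_4$ of its cylinder
masses is `mixSum O v v' n` up to $o(n)$. That sum is always at least $nv'$ (Hausdorff) and
infinitely often nearly $nv$ (packing). -/
theorem dim_levelSet_ge (hO : IsOscillating O) (ha : ∀ l, 0 < a l) (hb : ∀ l, 0 < b l)
    (hsa : ∑ l, a l = 1) (hsb : ∑ l, b l = 1) {α q q' : ℝ}
    (hq : ∑ l, gibbs a q l * -Real.logb 4 (a l) = α)
    (hq' : ∑ l, gibbs b q' l * -Real.logb 4 (b l) = α)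
    (hle : α * q' + tau b q' ≤ α * q + tau a q) :
    ENNReal.ofReal (α * q' + tau b q') ≤ dimH (levelSet (prodMeasure (mix O a b)) α) ∧
    ENNReal.ofReal (α * q + tau a q) ≤ packingDim (levelSet (prodMeasure (mix O a b)) α) := by
  have hW : IsWeights (mix O a b) := isWeights_mix ha hb hsa hsb
  set Q := mix O (gibbs a q) (gibbs b q') with hQ
  have hWQ : IsWeights Q := isWeights_mix_gibbs ha hb q q'
  set ν := prodMeasure Q with hν
  have hprob : IsProbabilityMeasure ν := isProbabilityMeasure_prodMeasure hWQ
  set v := α * q + tau a q with hv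
  set v' := α * q' + tau b q' with hv'
  have hva := sum_gibbs_mul_neg_logb_gibbs ha hq
  have hvb := sum_gibbs_mul_neg_logb_gibbs hb hq'
  have hlocal : ∀ᵐ x ∂ν, x ∈ levelSet (prodMeasure (mix O a b)) α := by
    have h := ae_tendsto_average_mix (O := O) (gibbs_pos ha q) (gibbs_pos hb q')
      (sum_gibbs ha q) (sum_gibbs hb q')
      (f := fun l => -Real.logb 4 (a l) - α) (f' := fun l => -Real.logb 4 (b l) - α)
      (by simp only [mul_sub, Finset.sum_sub_distrib, ← Finset.sum_mul, hq, sum_gibbs ha]; ring)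
      (by simp only [mul_sub, Finset.sum_sub_distrib, ← Finset.sum_mul, hq', sum_gibbs hb]; ring)
    filter_upwards [h] with x hx
    rw [mem_levelSet_prodMeasure hW]
    have h2 := hx.add_const α
    rw [zero_add] at h2
    refine h2.congr' ?_
    filter_upwards [eventually_gt_atTop 0] with n hn
    have hn' : (n : ℝ) ≠ 0 := by exact_mod_cast hn.ne'
    have e : ∑ i ∈ Finset.range n, mix O (fun l => -Real.logb 4 (a l) - α)
        (fun l => -Real.logb 4 (b l) - α) i (x i) = cost (mix O a b) n (word x n) - n * α := by
      have e2 : ∀ i, mix O (fun l => -Real.logb 4 (a l) - α)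
        (fun l => -Real.logb 4 (b l) - α) i (x i) = -Real.logb 4 (mix O a b i (x i)) - α := by
        intro i; unfold mix; split_ifs <;> rfl
      simp only [e2, cost_word, Finset.sum_sub_distrib, Finset.sum_const, Finset.card_range,
        nsmul_eq_mul]
    rw [e]
    field_simp; ring
  have hentropy : ∀ᵐ x ∂ν, Tendsto (fun n : ℕ => (cost Q n (word x n) - mixSum O v v' n) / n)
      atTop (𝓝 0) := by
    have h := ae_tendsto_average_mix (O := O) (gibbs_pos ha q) (gibbs_pos hb q')
      (sum_gibbs ha q) (sum_gibbs hb q')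
      (f := fun l => -Real.logb 4 (gibbs a q l) - v)
      (f' := fun l => -Real.logb 4 (gibbs b q' l) - v')
      (by simp only [mul_sub, Finset.sum_sub_distrib, ← Finset.sum_mul, hva, sum_gibbs ha]; ring)
      (by simp only [mul_sub, Finset.sum_sub_distrib, ← Finset.sum_mul, hvb, sum_gibbs hb]; ring)
    filter_upwards [h] with x hx
    refine hx.congr fun n => ?_
    rw [cost_word, mixSum, ← Finset.sum_sub_distrib]
    congr 1
    refine Finset.sum_congr rfl fun i _ => ?_
    rw [hQ]; unfold mix; split_ifs <;> rfl
  have hev : ∀ ε : ℝ, 0 < ε → ∀ᵐ x ∂ν, x ∈ ⋃ K : ℕ,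
      {x | ∀ n, K ≤ n → mixSum O v v' n - n * ε ≤ cost Q n (word x n)} := by
    intro ε hε
    filter_upwards [hentropy] with x hx
    obtain ⟨K, hK⟩ := eventually_atTop.1
      ((hx.eventually_const_lt (neg_lt_zero.2 hε)).and (eventually_gt_atTop 0))
    refine Set.mem_iUnion.2 ⟨K, fun n hn => ?_⟩
    obtain ⟨k1, k2⟩ := hK n hn
    have k3 : (0 : ℝ) < n := by exact_mod_cast k2
    rw [lt_div_iff₀ k3] at k1
    linarith
  have hne : ∀ ε : ℝ, 0 < ε → ν (levelSet (prodMeasure (mix O a b)) α ∩ ⋃ K : ℕ,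
      {x | ∀ n, K ≤ n → mixSum O v v' n - n * ε ≤ cost Q n (word x n)}) ≠ 0 := by
    intro ε hε h0
    have := (hlocal.and (hev ε hε)).and (measure_eq_zero_iff_ae_notMem.1 h0)
    obtain ⟨x, hx⟩ := this.exists
    exact hx.2 hx.1
  constructor
  · refine ENNReal.le_of_forall_nnreal_lt fun t ht => ?_
    have htv : (t : ℝ) < v' := by
      rwa [← ENNReal.ofReal_coe_nnreal, ENNReal.ofReal_lt_ofReal_iff_of_nonneg t.coe_nonneg] at ht
    set ε := (v' - t) / 2 with hε
    have hε0 : 0 < ε := by rw [hε]; linarith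
    obtain ⟨K, hK⟩ : ∃ K : ℕ, ν (levelSet (prodMeasure (mix O a b)) α ∩
        {x | ∀ n, K ≤ n → mixSum O v v' n - n * ε ≤ cost Q n (word x n)}) ≠ 0 := by
      by_contra hc
      push Not at hc
      refine hne ε hε0 ?_
      rw [Set.inter_iUnion]
      exact measure_iUnion_null hc
    obtain ⟨N, hN⟩ := eventually_atTop.1
      ((tendsto_natCast_mul_atTop hε0).eventually_ge_atTop (t : ℝ))
    refine le_dimH_of_measure_cyl_le ν (N := max N K) ?_ hK fun x hx n hn => ?_
    · have : {x : SymbolicSpace | ∀ n, K ≤ n → mixSum O v v' n - n * ε ≤ cost Q n (word x n)} =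
          ⋂ n : ℕ, {x | K ≤ n → mixSum O v v' n - n * ε ≤ cost Q n (word x n)} := by
        ext x; simp
      rw [this]
      refine MeasurableSet.iInter fun n => measurableSet_of_word (n := n) fun x y hxy hx => ?_
      simpa only [Set.mem_ofPred_eq, ← hxy] using hx
    · rw [hν, prodMeasure_cyl hWQ]
      refine pow4_le_pow4 ?_
      have k1 := hx n ((le_max_right _ _).trans hn)
      have k2 := hN n ((le_max_left _ _).trans hn)
      have k3 := le_mixSum (O := O) hle n
      have e : (n : ℝ) * v' = n * t + n * ε + n * ε := by rw [hε]; ring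
      linarith
  · refine ENNReal.le_of_forall_nnreal_lt fun t ht => ?_
    have htv : (t : ℝ) < v := by
      rwa [← ENNReal.ofReal_coe_nnreal, ENNReal.ofReal_lt_ofReal_iff_of_nonneg t.coe_nonneg] at ht
    set ε := (v - t) / 3 with hε
    have hε0 : 0 < ε := by rw [hε]; linarith
    refine le_iSup₂ (f := fun (t : ℝ≥0) (_ : packing (fun p : SymbolicSpace × ℝ =>
      ENNReal.ofReal p.2 ^ (t : ℝ)) (levelSet (prodMeasure (mix O a b)) α) = ∞) => (t : ℝ≥0∞)) t ?_
    refine packing_eq_top ν _ (hne ε hε0) fun K M => ?_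
    obtain ⟨c, hc⟩ := exists_le_pow4 M
    have hev' := (tendsto_natCast_mul_atTop hε0).eventually_ge_atTop (c - t)
    refine ((hO.frequently_le_mixSum hle hε0).and_eventually
      (hev'.and (eventually_ge_atTop K))).mono fun n hn x hx => ?_
    obtain ⟨k1, k2, k3⟩ := hn
    have k4 := hx n k3
    rw [hν, prodMeasure_cyl hWQ, ← pow4_logb (radius_pos n), logb_radius, pow4_rpow]
    refine (mul_le_mul_left hc _).trans ?_
    rw [← pow4_add]
    refine pow4_le_pow4 ?_
    have e : (n : ℝ) * (v - ε) = n * t + n * ε + n * ε := by rw [hε]; ring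
    linarith

/-- Dimensions of the level sets for independent letters with oscillating alternating weights. -/
theorem dim_levelSet_eq (hO : IsOscillating O) (ha : ∀ l, 0 < a l) (hb : ∀ l, 0 < b l)
    (hsa : ∑ l, a l = 1) (hsb : ∑ l, b l = 1) (hq : ∀ q, tau b q ≤ tau a q) {α : ℝ}
    {l m l' m' : Fin 4} (h1 : -Real.logb 4 (a l) < α) (h2 : α < -Real.logb 4 (a m))
    (h1' : -Real.logb 4 (b l') < α) (h2' : α < -Real.logb 4 (b m')) :
    ((dimH (levelSet (prodMeasure (mix O a b)) α) : ℝ≥0∞) : EReal) =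
      legendre (olsenb (prodMeasure (mix O a b))) α ∧
    ((packingDim (levelSet (prodMeasure (mix O a b)) α) : ℝ≥0∞) : EReal) =
      legendre (olsenB (prodMeasure (mix O a b))) α := by
  obtain ⟨q, hmin, hα⟩ := exists_legendre_min ha h1 h2
  obtain ⟨q', hmin', hα'⟩ := exists_legendre_min hb h1' h2'
  -- Minimality at $q'$, compared at $q$, followed by $\tau_b(q)\le\tau_a(q)$.
  have hle : α * q' + tau b q' ≤ α * q + tau a q := (hmin' q).trans (by linarith [hq q])
  have hnn := legendre_value_nonneg ha hα
  have hnn' := legendre_value_nonneg hb hα'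
  obtain ⟨g1, g2⟩ := dim_levelSet_ge hO ha hb hsa hsb hα hα' hle
  have d1 := le_antisymm (dimH_levelSet_le hO ha hb hsa hsb (α := α) (hq q')) g1
  have d2 := le_antisymm (packingDim_levelSet_le (O := O) ha hb hsa hsb (α := α) (hq q)) g2
  have key : ∀ {f : ℝ → EReal} {p : Fin 4 → ℝ} {q : ℝ}, (∀ y, f y = tau p y) →
      (∀ y, α * q + tau p q ≤ α * y + tau p y) →
      legendre f α = ((α * q + tau p q : ℝ) : EReal) := by
    intro f p q hf hm
    unfold legendre
    simp only [hf, ← EReal.coe_add]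
    exact le_antisymm (iInf_le _ q) (le_iInf fun y => EReal.coe_le_coe_iff.2 (hm y))
  rw [d1, d2, key (fun y => olsenb_prodMeasure hO ha hb hsa hsb (hq y)) hmin',
    key (fun y => olsenB_prodMeasure hO ha hb hsa hsb (hq y)) hmin, EReal.coe_ennreal_ofReal,
    EReal.coe_ennreal_ofReal, max_eq_left hnn, max_eq_left hnn']
  exact ⟨rfl, rfl⟩

end Alternating

/-! ## Rapidly growing blocks -/

theorem mix_not {γ : Type*} (O : ℕ → Prop) (y z : γ) (i : ℕ) :
    mix (fun i => ¬ O i) y z i = mix O z y i := by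
  by_cases h : O i <;> simp [mix, h]

theorem mixSum_not (O : ℕ → Prop) (y z : ℝ) (n : ℕ) :
    mixSum (fun i => ¬ O i) y z n = mixSum O z y n :=
  Finset.sum_congr rfl fun i _ => mix_not O y z i

/-- The condition is symmetric, so exchanging the roles of $a$ and $b$ amounts to replacing $O$ by
its complement. -/
theorem IsOscillating.not {O : ℕ → Prop} (hO : IsOscillating O) : IsOscillating fun i => ¬ O i := by
  intro η hη
  simp only [mixSum_not]
  exact (hO η hη).symm

theorem sum_range_le_of_nonpos {g : ℕ → ℝ} (h1 : ∀ i, g i ≤ 1) {m n : ℕ} (hmn : m ≤ n)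
    (h0 : ∀ i, m ≤ i → i < n → g i ≤ 0) : ∑ i ∈ Finset.range n, g i ≤ m := by
  rw [← Finset.sum_range_add_sum_Ico g hmn]
  have k1 : ∑ i ∈ Finset.range m, g i ≤ ∑ i ∈ Finset.range m, (1 : ℝ) :=
    Finset.sum_le_sum fun i _ => h1 i
  have k2 : ∑ i ∈ Finset.Ico m n, g i ≤ 0 := Finset.sum_nonpos fun i hi =>
    h0 i (Finset.mem_Ico.1 hi).1 (Finset.mem_Ico.1 hi).2
  simp only [Finset.sum_const, Finset.card_range, nsmul_eq_mul, mul_one] at k1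
  linarith

section Blocks

variable {T : ℕ → ℕ}

theorem block_le_block (hT : ∀ k, 1 ≤ k → T k < T (k + 1)) {j k : ℕ} (hj : 1 ≤ j) (hjk : j ≤ k) :
    T j ≤ T k := by
  induction k, hjk using Nat.le_induction with
  | base => exact le_rfl
  | succ k hk ih => exact ih.trans (hT k (hj.trans hk)).le

theorem self_le_block (hT1 : T 1 = 1) (hT : ∀ k, 1 ≤ k → T k < T (k + 1)) {k : ℕ} (hk : 1 ≤ k) :
    k ≤ T k := by
  induction k, hk using Nat.le_induction with
  | base => exact hT1.ge
  | succ k hk ih => exact Nat.succ_le_of_lt (ih.trans_lt (hT k hk))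

theorem eventually_block_le (hT1 : T 1 = 1) (hT : ∀ k, 1 ≤ k → T k < T (k + 1))
    (hlim : Tendsto (fun k : ℕ => (T (k + 1) : ℝ) / (T k : ℝ)) atTop atTop) {η : ℝ} (hη : 0 < η) :
    ∀ᶠ k in atTop, (T k : ℝ) ≤ ((T (k + 1) - 1 : ℕ) : ℝ) * η := by
  -- The factor $2$ absorbs the shift by one: $T_{k+1}-1\ge T_{k+1}/2$.
  filter_upwards [hlim.eventually_ge_atTop (2 / η), eventually_ge_atTop 1] with k hk hk1
  have h1 := self_le_block hT1 hT hk1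
  have h2 := hT k hk1
  have hpos : (0 : ℝ) < T k := by exact_mod_cast (by omega : 0 < T k)
  rw [le_div_iff₀ hpos, div_mul_eq_mul_div, div_le_iff₀ hη] at hk
  have h3 : (2 : ℝ) ≤ T (k + 1) := by exact_mod_cast (by omega : 2 ≤ T (k + 1))
  rw [Nat.cast_sub (by omega)]
  push_cast
  nlinarith

/-- At the end of a block, letters of the other kind all come before its start, a negligible
fraction of the total. Lengths are $T_{k+1}-1$ because index $i$ is position $i+1$. -/
theorem isOscillating_inOddBlock (hT1 : T 1 = 1) (hT : ∀ k, 1 ≤ k → T k < T (k + 1))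
    (hlim : Tendsto (fun k : ℕ => (T (k + 1) : ℝ) / (T k : ℝ)) atTop atTop) :
    IsOscillating fun i => InOddBlock T (i + 1) := by
  intro η hη
  obtain ⟨N, hN⟩ := eventually_atTop.1 (eventually_block_le hT1 hT hlim hη)
  have hle : ∀ (O : ℕ → Prop) i, mix O (0 : ℝ) 1 i ≤ 1 ∧ mix O (1 : ℝ) 0 i ≤ 1 := fun O i =>
    ⟨mix_of (R := fun y : ℝ => y ≤ 1) i zero_le_one le_rfl,
      mix_of (R := fun y : ℝ => y ≤ 1) i le_rfl zero_le_one⟩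
  constructor <;> refine frequently_atTop.2 fun K => ?_
  · obtain ⟨k, hk⟩ : ∃ k, k = N + K := ⟨_, rfl⟩
    have h1 := hT (2 * k + 1) (by omega)
    have h2 := self_le_block hT1 hT (k := 2 * k + 1) (by omega)
    refine ⟨T (2 * k + 2) - 1, ?_, le_trans ?_ (hN (2 * k + 1) (by omega))⟩
    · simp only [Nat.add_assoc, Nat.reduceAdd] at h1
      omega
    · refine sum_range_le_of_nonpos (fun i => (hle _ i).1) ?_ fun i hi hi' => ?_
      · exact Nat.le_sub_one_of_lt h1
      · have : InOddBlock T (i + 1) := by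
          refine ⟨k + 1, by omega, ?_, ?_⟩
          · rw [show 2 * (k + 1) - 1 = 2 * k + 1 by omega]; omega
          · rw [show 2 * (k + 1) = 2 * k + 2 by omega]; omega
        unfold mix; rw [if_pos this]
  · obtain ⟨k, hk⟩ : ∃ k, k = N + K + 1 := ⟨_, rfl⟩
    have h1 := hT (2 * k) (by omega)
    have h2 := self_le_block hT1 hT (k := 2 * k) (by omega)
    refine ⟨T (2 * k + 1) - 1, by omega, le_trans ?_ (hN (2 * k) (by omega))⟩
    refine sum_range_le_of_nonpos (fun i => (hle _ i).2) (Nat.le_sub_one_of_lt h1)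
      fun i hi hi' => ?_
    have : ¬ InOddBlock T (i + 1) := by
      rintro ⟨k', hk', hl, hu⟩
      rcases le_or_gt k' k with hc | hc
      · have := block_le_block hT (j := 2 * k') (k := 2 * k) (by omega) (by omega)
        omega
      · have := block_le_block hT (j := 2 * k + 1) (k := 2 * k' - 1) (by omega) (by omega)
        omega
    unfold mix; rw [if_neg this]

theorem inhomMeasure_eq_prodMeasure (T : ℕ → ℕ) (a b : Fin 4 → ℝ) :
    inhomMeasure T a b = prodMeasure (mix (fun i => InOddBlock T (i + 1)) a b) := rfl

theorem inhomMeasure_eq_prodMeasure_not (T : ℕ → ℕ) (a b : Fin 4 → ℝ) :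
    inhomMeasure T b a = prodMeasure (mix (fun i => ¬ InOddBlock T (i + 1)) a b) := by
  have e : mix (fun i => ¬ InOddBlock T (i + 1)) a b = mix (fun i => InOddBlock T (i + 1)) b a :=
    funext fun i => mix_not _ a b i
  rw [e]; rfl

end Blocks

end OlsenMultifractal

open OlsenMultifractal in
theorem theorem13
    (T : ℕ → ℕ) (hT1 : T 1 = 1) (hTlt : ∀ k, 1 ≤ k → T k < T (k + 1))
    (hTlim : Tendsto (fun k : ℕ => (T (k + 1) : ℝ) / (T k : ℝ)) atTop atTop)
    (a b : Fin 4 → ℝ)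
    (ha_pos : ∀ i, 0 < a i) (hb_pos : ∀ i, 0 < b i)
    (ha_sum : ∑ i, a i = 1) (hb_sum : ∑ i, b i = 1)
    (ha_mono : StrictMono a) (hb_mono : StrictMono b)
    (h_theta0 : deriv (theta a) 0 = deriv (theta b) 0)
    (h_theta1 : deriv (theta a) 1 = deriv (theta b) 1)
    (hab : a 0 < b 0)
    (μ : Measure SymbolicSpace)
    (hμ : μ = inhomMeasure T a b ∨ μ = inhomMeasure T b a) :
    (∀ q : ℝ, olsenB μ q = ((Real.logb 4 (∑ i, a i ^ q) : ℝ) : EReal)) ∧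
    (∀ q : ℝ, olsenb μ q = ((Real.logb 4 (∑ i, b i ^ q) : ℝ) : EReal)) ∧
    ∀ α ∈ Set.Ioo (-Real.logb 4 (b 3)) (-Real.logb 4 (b 0)),
      ((dimH (levelSet μ α) : ℝ≥0∞) : EReal) = legendre (olsenb μ) α ∧
      ((packingDim (levelSet μ α) : ℝ≥0∞) : EReal) = legendre (olsenB μ) α := by
  obtain ⟨hba, hsum⟩ := sum_rpow_le ha_pos hb_pos ha_sum hb_sum ha_mono hb_mono h_theta0 h_theta1 hab
  have hτ : ∀ q, tau b q ≤ tau a q := fun q =>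
    Real.logb_le_logb_of_le (by norm_num) (sum_rpow_pos hb_pos q) (hsum q)
  obtain ⟨O, hO, rfl⟩ : ∃ O, IsOscillating O ∧ μ = prodMeasure (mix O a b) := by
    have hosc := isOscillating_inOddBlock hT1 hTlt hTlim
    rcases hμ with rfl | rfl
    · exact ⟨_, hosc, inhomMeasure_eq_prodMeasure T a b⟩
    · exact ⟨_, hosc.not, inhomMeasure_eq_prodMeasure_not T a b⟩
  refine ⟨fun q => olsenB_prodMeasure hO ha_pos hb_pos ha_sum hb_sum (hτ q),
    fun q => olsenb_prodMeasure hO ha_pos hb_pos ha_sum hb_sum (hτ q), fun α hα => ?_⟩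
  -- Since `a 0 < b 0` and `b 3 < a 3`, the exponent interval of $b$ lies inside that of $a$, so
  -- both Legendre minima are attained.
  have h3 := Real.logb_lt_logb (b := 4) (by norm_num) (hb_pos 3) hba
  have h0 := Real.logb_lt_logb (b := 4) (by norm_num) (ha_pos 0) hab
  exact dim_levelSet_eq hO ha_pos hb_pos ha_sum hb_sum hτ (l := 3) (m := 0) (l' := 3) (m' := 0)
    (by linarith [hα.1]) (by linarith [hα.2]) hα.1 hα.2
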